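/- Let $n\ge 1$, let $\mathbb{B}^n$ be the open unit ball of $\mathbb{C}^n$, let $d(z)$ be the Euclidean distance from $z\in\mathbb{B}^n$ to $\partial\mathbb{B}^n$, let $dV_N$ be the normalized Lebesgue volume measure on $\mathbb{B}^n$ and $d\sigma$ the normalized Lebesgue surface measure on $\partial\mathbb{B}^n$. For a $\mathcal{C}^1$ function $f:\mathbb{B}^n\to\mathbb{C}$ put $$\|D_f\|=\Big(\sum_{k=1}^n|f_{z_k}|^2+\sum_{k=1}^n|f_{\overline z_k}|^2\Big)^{1/2},\qquad \Delta=\sum_{k=1}^n\Big(\frac{\partial^2}{\partial x_k^2}+\frac{\partial^2}{\partial y_k^2}\Big)\quad(z_k=x_k+iy_k).$$ We use the following classes of functions $f:\mathbb{B}^n\to\mathbb{C}$. * $\mathcal{HZ}_3(\mathbb{B}^n)$: all $f\in\mathcal{C}^3(\mathbb{B}^n)$ for which there are nonnegative continuous functions $a,b,c$ on $\mathbb{B}^n$ with $|\Delta f|\le a\|D_f\|+b|f|+c$ on $\mathbb{B}^n$. * $\mathcal{D}_{\gamma,\alpha}(\mathbb{B}^n)$: all $f\in\mathcal{C}^1(\mathbb{B}^n)$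 with $|f(0)|+\big(\int_{\mathbb{B}^n}d(z)^{\gamma}\|D_f(z)\|^{\alpha}\,dV_N(z)\big)^{1/\alpha}<\infty$. * $\mathcal{H}_g^p(\mathbb{B}^n)$, $0<p<\infty$: all measurable $f$ for which $M_p(r,f)=\big(\int_{\partial\mathbb{B}^n}|f(r\zeta)|^p\,d\sigma(\zeta)\big)^{1/p}$ exists for all $r\in(0,1)$ and $\sup_{0<r<1}M_p(r,f)<\infty$. * $b_{\nu,p}(\mathbb{B}^n)$, $\nu>-1$, $0<p<\infty$: all continuous $f$ with $|f(0)|+\big(\int_{\mathbb{B}^n}d(z)^{\nu}|f(z)|^{p}\,dV_N(z)\big)^{1/p}<\infty$. Let $2\le\alpha\le 2n$, $\gamma>0$, $q=(2n+\gamma)/\alpha-1$, and let $\tau,\eta\ge 0$ be constants. Suppose that $f\in\mathcal{HZ}_3(\mathbb{B}^n)\cap\mathcal{D}_{\gamma,\alpha}(\mathbb{B}^n)$ satisfies the non-homogeneous Yukawa equation $$\Delta f(z)=\tau f(z)+\eta\,\mathrm{Re}\big(f(z)\big),\qquad z\in\mathbb{B}^n.$$ (1) If $p=1/q\ge 2$,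 then $f\in\mathcal{H}_g^p(\mathbb{B}^n)$. (2) If $p\ge 2$ and $pq\ge 2$, then $f\in b_{pq-2,p}(\mathbb{B}^n)$. -/

import Mathlib

open MeasureTheory Metric Set Topology Laplacian
open scoped ENNReal

/-- The complex space `ℂⁿ` with its Euclidean (Hermitian) norm. -/
abbrev Cn (n : ℕ) : Type := EuclideanSpace ℂ (Fin n)

namespace YukawaBall

/-- The open unit ball `𝔹ⁿ` of `ℂⁿ`. -/
abbrev unitBall (n : ℕ) : Set (Cn n) := ball (0 : Cn n) 1

/-- Euclidean distance from `z` to the boundary of the unit ball. -/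
noncomputable def bdryDist {n : ℕ} (z : Cn n) : ℝ := infDist z (frontier (unitBall n))

/-- `f_{z_k} = (1/2) (∂f/∂x_k - i ∂f/∂y_k)`. -/
noncomputable def dz {n : ℕ} (k : Fin n) (f : Cn n → ℂ) (z : Cn n) : ℂ :=
  (1 / 2) * (fderiv ℝ f z (EuclideanSpace.single k 1)
    - Complex.I * fderiv ℝ f z (EuclideanSpace.single k Complex.I))

/-- `f_{z̄_k} = (1/2) (∂f/∂x_k + i ∂f/∂y_k)`. -/
noncomputable def dzbar {n : ℕ} (k : Fin n) (f : Cn n → ℂ) (z : Cn n) : ℂ :=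
  (1 / 2) * (fderiv ℝ f z (EuclideanSpace.single k 1)
    + Complex.I * fderiv ℝ f z (EuclideanSpace.single k Complex.I))

/-- The Hilbert-Schmidt seminorm `‖D_f‖ = (‖∇f‖² + ‖∇̄f‖²)^{1/2}`. -/
noncomputable def normD {n : ℕ} (f : Cn n → ℂ) (z : Cn n) : ℝ :=
  √(∑ k, ‖dz k f z‖ ^ 2 + ∑ k, ‖dzbar k f z‖ ^ 2)

/-- Normalized Lebesgue volume measure of the unit ball, as a measure on `ℂⁿ`. -/
noncomputable def normVolume (n : ℕ) : Measure (Cn n) :=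
  (volume (unitBall n))⁻¹ • volume.restrict (unitBall n)

/-- Normalized Lebesgue surface measure on the unit sphere. -/
noncomputable def normSurface (n : ℕ) : Measure (sphere (0 : Cn n) 1) :=
  ((volume : Measure (Cn n)).toSphere univ)⁻¹ • (volume : Measure (Cn n)).toSphere

/-- The integral mean `M_p(r, f)`, for `0 < p < ∞`. -/
noncomputable def integralMean {n : ℕ} (p r : ℝ) (f : Cn n → ℂ) : ℝ :=
  (∫ ζ : sphere (0 : Cn n) 1, ‖f (r • (ζ : Cn n))‖ ^ p ∂(normSurface n)) ^ (1 / p)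

/-- The generalized Hardy space `H_g^p`, for `0 < p < ∞`: functions measurable on the ball whose
integral means all exist and are bounded. -/
def hardySpace (n : ℕ) (p : ℝ) : Set (Cn n → ℂ) :=
  {f | Measurable (fun z : unitBall n => f z) ∧
    (∀ r ∈ Ioo (0 : ℝ) 1, Integrable
      (fun ζ : sphere (0 : Cn n) 1 => ‖f (r • (ζ : Cn n))‖ ^ p) (normSurface n)) ∧
    BddAbove ((fun r => integralMean p r f) '' Ioo (0 : ℝ) 1)}

/-- The Dirichlet-type energy integral `∫ d(z)^ν |f(z)|^μ ‖D_f(z)‖^t dV_N(z)`, with values in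
`[0, ∞]`; here `x ^ 0 = 1` for every `x`. -/
noncomputable def energy {n : ℕ} (f : Cn n → ℂ) (ν μ t : ℝ) : ℝ≥0∞ :=
  ∫⁻ z, ENNReal.ofReal (bdryDist z) ^ ν * ENNReal.ofReal ‖f z‖ ^ μ
    * ENNReal.ofReal (normD f z) ^ t ∂(normVolume n)

/-- The Dirichlet-type space `D_{ν,t}` (`ν ≥ 0`, `0 < t < ∞`). -/
def dirichletSpace (n : ℕ) (ν t : ℝ) : Set (Cn n → ℂ) :=
  {f | ContDiffOn ℝ 1 f (unitBall n) ∧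
    ENNReal.ofReal ‖f 0‖ + energy f ν 0 t ^ (1 / t) < ⊤}

/-- The Bergman-type space `b_{ν,μ}` (`ν > -1`, `0 < μ < ∞`). -/
def bergmanSpace (n : ℕ) (ν μ : ℝ) : Set (Cn n → ℂ) :=
  {f | ContinuousOn f (unitBall n) ∧
    ENNReal.ofReal ‖f 0‖ + energy f ν μ 0 ^ (1 / μ) < ⊤}

/-- The class `HZ_m`: functions of class `C^m` on the ball satisfying Heinz's nonlinear
differential inequality. `Δ` is the Laplacian of `ℂⁿ` viewed as a real inner product space. -/
def heinzClass (n m : ℕ) : Set (Cn n → ℂ) :=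
  {f | ContDiffOn ℝ m f (unitBall n) ∧ ∃ a b c : Cn n → ℝ,
    ContinuousOn a (unitBall n) ∧ ContinuousOn b (unitBall n) ∧ ContinuousOn c (unitBall n) ∧
    (∀ z ∈ unitBall n, 0 ≤ a z ∧ 0 ≤ b z ∧ 0 ≤ c z) ∧
    ∀ z ∈ unitBall n, ‖Δ f z‖ ≤ a z * normD f z + b z * ‖f z‖ + c z}

/-- `f` is a `C²` solution in the ball of `Δ f = τ f + η Re f`. -/
def SolvesYukawa {n : ℕ} (τ η : Cn n → ℝ) (f : Cn n → ℂ) : Prop :=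
  ContDiffOn ℝ 2 f (unitBall n) ∧
    ∀ z ∈ unitBall n, Δ f z = (τ z : ℂ) * f z + (η z : ℂ) * ((f z).re : ℂ)

end YukawaBall

/-! Write `m = 2n`, so that `(q + 1) * α = m + γ`, and let `U = (1 + |f|²)^{p/2}`, a `C²` majorant
of `|f|^p`.

Growth. The equation is linear over `ℝ` with constant nonnegative coefficients, so every directional
derivative of `f` solves it too, and its squared modulus is subharmonic. The sub-mean value property
on the ball of radius `(1 - ‖z‖)/2`, combined with the finite Dirichlet energy, gives `‖Df(z)‖ ≤ C
(1 - ‖z‖)^{-(q+1)}` (`exists_norm_fderiv_le`). Integration along rays gives `|f(z)| ≤ B (1 -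
‖z‖)^{-q}` (`exists_norm_le_of_norm_fderiv_le`).

Weighted energy. Let `W = (1 + |f|²)^{(p-2)/2} ‖Df‖²`. The growth of `f` yields `(1 - ‖z‖)^{pq} W ≤
C ((1 - ‖z‖)^q ‖Df‖)² ≤ C (1 + (1 - ‖z‖)^{qα} ‖Df‖^α)`. Since `α ≤ 2n` means `γ ≤ qα`, the right
side is controlled by the Dirichlet energy and is integrable (`weighted_energy_le`).

Hardy space. A computation gives `0 ≤ ΔU ≤ C (W + U)` (`laplacian_regPow_bounds`). When `pq = 1`,
`(1 - ‖z‖) W` is integrable and `(1 - ‖z‖) U` is bounded, so `(1 - ‖z‖) ΔU` is integrable. By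
Green's formula this bounds the spherical means of the subharmonic function `U`
(`sphereIntegral_le_of_subharmonic`).

Bergman space. Along each ray `(U')² ≤ p² U W`. A one-dimensional Hardy inequality with exponent `s
= pq > 1` bounds `∫ (1 - t)^{s-2} U` by a boundary term plus `∫ (1 - t)^s W` (`lintegral_hardy_le`),
and integrating over the sphere finishes. -/

namespace YukawaBall

/-! ### Polar coordinates. -/

section Polar

variable {E : Type*} [NormedAddCommGroup E] [NormedSpace ℝ E] [FiniteDimensional ℝ E]
  [MeasurableSpace E] [BorelSpace E] [Nontrivial E] (μ : Measure E) [μ.IsAddHaarMeasure]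

theorem lintegral_volumeIoiPow (n : ℕ) (g : ℝ → ℝ≥0∞) (hg : Measurable g) :
    ∫⁻ t, g t ∂(Measure.volumeIoiPow n) = ∫⁻ t in Ioi (0 : ℝ), ENNReal.ofReal (t ^ n) * g t := by
  rw [Measure.volumeIoiPow, lintegral_withDensity_eq_lintegral_mul _ (by fun_prop)
    (g := fun t : Ioi (0 : ℝ) => g t) (hg.comp measurable_subtype_coe)]
  simp only [Pi.mul_apply]
  exact lintegral_subtype_comap measurableSet_Ioi (fun t => ENNReal.ofReal (t ^ n) * g t)

theorem lintegral_polar (F : E → ℝ≥0∞) (hF : Measurable F) :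
    ∫⁻ z, F z ∂μ = ∫⁻ t in Ioi (0 : ℝ), ENNReal.ofReal (t ^ (Module.finrank ℝ E - 1)) *
      ∫⁻ ζ : sphere (0 : E) 1, F (t • (ζ : E)) ∂μ.toSphere := by
  have h1 : ∫⁻ z, F z ∂μ = ∫⁻ z : ({0}ᶜ : Set E), F z ∂(μ.comap (↑)) := by
    rw [lintegral_subtype_comap (measurableSet_singleton _).compl, restrict_compl_singleton]
  have h2 := (μ.measurePreserving_homeomorphUnitSphereProd).lintegral_comp
    (f := fun x : sphere (0 : E) 1 × Ioi (0 : ℝ) => F ((x.2 : ℝ) • (x.1 : E)))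
    (hF.comp (by fun_prop))
  have h3 : ∀ z : ({0}ᶜ : Set E), F (((homeomorphUnitSphereProd E z).2 : ℝ) •
      ((homeomorphUnitSphereProd E z).1 : E)) = F z := by
    intro z
    have hz : ‖(z : E)‖ ≠ 0 := norm_ne_zero_iff.2 z.2
    simp [smul_smul, hz]
  simp only [h3] at h2
  have h4 : Measurable fun x : sphere (0 : E) 1 × Ioi (0 : ℝ) => F ((x.2 : ℝ) • (x.1 : E)) :=
    hF.comp (by fun_prop)
  rw [h1, h2, lintegral_prod_symm _ h4.aemeasurable]
  exact lintegral_volumeIoiPow _ (fun t => ∫⁻ ζ : sphere (0 : E) 1, F (t • (ζ : E)) ∂μ.toSphere)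
    (Measurable.lintegral_prod_right' (f := fun x : ℝ × sphere (0 : E) 1 => F (x.1 • (x.2 : E)))
      (hF.comp (by fun_prop)))

/-- The rays are the inner integral here, so that a one-dimensional inequality can be applied on
each ray before integrating over the sphere. -/
theorem lintegral_polar_ray (F : E → ℝ≥0∞) (hF : Measurable F) :
    ∫⁻ z, F z ∂μ = ∫⁻ ζ : sphere (0 : E) 1, ∫⁻ t in Ioi (0 : ℝ),
      ENNReal.ofReal (t ^ (Module.finrank ℝ E - 1)) * F (t • (ζ : E)) ∂volume ∂μ.toSphere := by
  rw [lintegral_polar μ F hF, lintegral_lintegral_swap]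
  · refine lintegral_congr fun t => ?_
    have h0 : Measurable fun ζ : sphere (0 : E) 1 => F (t • (ζ : E)) := hF.comp (by fun_prop)
    rw [lintegral_const_mul _ h0]
  · have h1 : Measurable fun x : sphere (0 : E) 1 × ℝ => F (x.2 • (x.1 : E)) :=
      hF.comp (by fun_prop)
    have h2 : Measurable fun x : sphere (0 : E) 1 × ℝ =>
        ENNReal.ofReal (x.2 ^ (Module.finrank ℝ E - 1)) := by fun_prop
    exact (h2.mul h1).aemeasurable

theorem integral_polar (F : E → ℝ) (hF : Integrable F μ) :
    ∫ z, F z ∂μ = ∫ t in Ioi (0 : ℝ), t ^ (Module.finrank ℝ E - 1) *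
      ∫ ζ : sphere (0 : E) 1, F (t • (ζ : E)) ∂μ.toSphere := by
  have h1 : ∫ z, F z ∂μ = ∫ z : ({0}ᶜ : Set E), F z ∂(μ.comap (↑)) := by
    rw [integral_subtype_comap (measurableSet_singleton _).compl, restrict_compl_singleton]
  have h2 := (μ.measurePreserving_homeomorphUnitSphereProd).integral_comp
    (homeomorphUnitSphereProd E).measurableEmbedding
    (fun x : sphere (0 : E) 1 × Ioi (0 : ℝ) => F ((x.2 : ℝ) • (x.1 : E)))
  have h3 : ∀ z : ({0}ᶜ : Set E), F (((homeomorphUnitSphereProd E z).2 : ℝ) •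
      ((homeomorphUnitSphereProd E z).1 : E)) = F z := by
    intro z
    have hz : ‖(z : E)‖ ≠ 0 := norm_ne_zero_iff.2 z.2
    simp [smul_smul, hz]
  have h4 := (μ.measurePreserving_homeomorphUnitSphereProd).integrable_comp_emb
    (homeomorphUnitSphereProd E).measurableEmbedding
    (g := fun x : sphere (0 : E) 1 × Ioi (0 : ℝ) => F ((x.2 : ℝ) • (x.1 : E)))
  have h5 : Integrable (fun z : ({0}ᶜ : Set E) => F z) (μ.comap (↑)) :=
    ((MeasurableEmbedding.subtype_coe (measurableSet_singleton _).compl).integrable_map_iff).1 (by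
      rw [map_comap_subtype_coe (measurableSet_singleton _).compl, restrict_compl_singleton]
      exact hF)
  have h6 := h4.1 (h5.congr (Filter.Eventually.of_forall fun z => (h3 z).symm))
  simp only [h3] at h2
  rw [h1, h2, integral_prod_symm _ h6, Measure.volumeIoiPow,
    integral_withDensity_eq_integral_toReal_smul (by fun_prop)
      (Filter.Eventually.of_forall fun _ => ENNReal.ofReal_lt_top)]
  rw [← integral_subtype_comap measurableSet_Ioi
    (fun t : ℝ => t ^ (Module.finrank ℝ E - 1) *
      ∫ ζ : sphere (0 : E) 1, F (t • (ζ : E)) ∂μ.toSphere)]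
  refine integral_congr_ae (Filter.Eventually.of_forall fun t => ?_)
  have : (0 : ℝ) ≤ (t : ℝ) ^ (Module.finrank ℝ E - 1) := pow_nonneg (le_of_lt t.2) _
  simp [ENNReal.toReal_ofReal this]

end Polar

/-! ### Green's formula against radial test functions. -/

section Green

variable {E : Type*} [NormedAddCommGroup E] [InnerProductSpace ℝ E] [FiniteDimensional ℝ E]

theorem laplacian_eq_sum_fderiv {F : Type*} [NormedAddCommGroup F] [NormedSpace ℝ F] {u : E → F}
    {x : E} (hu : ContDiffAt ℝ 2 u x) :
    Δ u x = ∑ i, fderiv ℝ (fun y => fderiv ℝ u y (stdOrthonormalBasis ℝ E i)) x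
      (stdOrthonormalBasis ℝ E i) := by
  rw [InnerProductSpace.laplacian_eq_iteratedFDeriv_stdOrthonormalBasis]
  refine Finset.sum_congr rfl fun i _ => ?_
  have hd : DifferentiableAt ℝ (fderiv ℝ u) x :=
    (hu.fderiv_right (m := 1) (by norm_num)).differentiableAt (by norm_num)
  rw [iteratedFDeriv_two_apply]
  simp [fderiv_clm_apply hd (differentiableAt_const _)]

variable [MeasurableSpace E] [BorelSpace E] (μ : Measure E) [μ.IsAddHaarMeasure]

theorem integrable_mul_of_continuousOn_ball {R b : ℝ} (hb : b < R) {X g : E → ℝ}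
    (hX : Continuous X) (hX0 : ∀ z, b ≤ ‖z‖ → X z = 0) (hg : ContinuousOn g (ball 0 R)) :
    Integrable (fun z => X z * g z) μ := by
  have hs : closedBall (0 : E) b ⊆ ball 0 R := closedBall_subset_ball hb
  have h1 : IntegrableOn (fun z => X z * g z) (closedBall 0 b) μ :=
    (hX.continuousOn.mul (hg.mono hs)).integrableOn_compact (isCompact_closedBall _ _)
  refine (integrableOn_iff_integrable_of_support_subset ?_).1 h1
  intro z hz
  by_contra h
  simp only [mem_closedBall, dist_zero_right, not_le] at h
  exact hz (by simp [hX0 z h.le])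

/-- The test function `X(z) = ∫_{‖z‖²}^{b²} ψ` has gradient `-2 ψ(‖z‖²) z` and vanishes for `‖z‖ ≥
b`, so integrating by parts in each coordinate leaves no boundary term. Using the squared radius
keeps `X` differentiable at the origin. -/
theorem integral_radial_mul_laplacian {R b : ℝ} (hb0 : 0 ≤ b) (hb : b < R) {u : E → ℝ}
    (hu : ContDiffOn ℝ 2 u (ball 0 R)) {ψ : ℝ → ℝ} (hψ : Continuous ψ)
    (hψ0 : ∀ s, b ^ 2 ≤ s → ψ s = 0) :
    ∫ z, (∫ s in (‖z‖ ^ 2)..(b ^ 2), ψ s) * Δ u z ∂μ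
      = ∫ z, (2 * ψ (‖z‖ ^ 2)) * fderiv ℝ u z z ∂μ := by
  set X : E → ℝ := fun z => ∫ s in (‖z‖ ^ 2)..(b ^ 2), ψ s with hXdef
  set e := stdOrthonormalBasis ℝ E
  have hX' : ∀ z, HasFDerivAt X ((-ψ (‖z‖ ^ 2)) • ((2 : ℕ) • innerSL ℝ z)) z := by
    intro z
    have h1 : HasDerivAt (fun t => ∫ s in t..(b ^ 2), ψ s) (-ψ (‖z‖ ^ 2)) (‖z‖ ^ 2) :=
      intervalIntegral.integral_hasDerivAt_left (hψ.intervalIntegrable _ _)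
        hψ.stronglyMeasurable.stronglyMeasurableAtFilter hψ.continuousAt
    exact h1.comp_hasFDerivAt z (hasStrictFDerivAt_norm_sq z).hasFDerivAt
  have hXc : Continuous X := continuous_iff_continuousAt.2 fun z => (hX' z).continuousAt
  have hX0 : ∀ z, b ≤ ‖z‖ → X z = 0 := by
    intro z hz
    have hz2 : b ^ 2 ≤ ‖z‖ ^ 2 := by gcongr
    rw [hXdef]
    dsimp only
    rw [intervalIntegral.integral_congr (g := fun _ => 0)]
    · simp
    · intro s hs
      rw [uIcc_of_ge hz2] at hs
      exact hψ0 s hs.1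
  have hball : ∀ z ∈ ball (0 : E) R, ContDiffAt ℝ 2 u z := fun z hz =>
    hu.contDiffAt (isOpen_ball.mem_nhds hz)
  have htX : tsupport X ⊆ ball 0 R := by
    refine (closure_minimal (fun z hz => ?_) isClosed_closedBall).trans
      (closedBall_subset_ball hb : closedBall (0 : E) b ⊆ ball 0 R)
    by_contra h
    simp only [mem_closedBall, dist_zero_right, not_le] at h
    exact hz (hX0 z h.le)
  have hd : ContDiffOn ℝ 1 (fderiv ℝ u) (ball 0 R) :=
    hu.fderiv_of_isOpen isOpen_ball (by norm_num)
  have hdi : ∀ i, ContDiffOn ℝ 1 (fun y => fderiv ℝ u y (e i)) (ball 0 R) := fun i =>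
    hd.clm_apply contDiffOn_const
  have hddi : ∀ i, ContinuousOn (fun z => fderiv ℝ (fun y => fderiv ℝ u y (e i)) z (e i))
      (ball 0 R) := fun i =>
    (((hdi i).fderiv_of_isOpen (m := 0) isOpen_ball (by norm_num)).continuousOn).clm_apply
      continuousOn_const
  have hX'' : ∀ z v, fderiv ℝ X z v = -(2 * ψ (‖z‖ ^ 2)) * inner ℝ z v := by
    intro z v
    rw [(hX' z).fderiv]
    simp
    ring
  have hψn : ∀ z : E, b ≤ ‖z‖ → ψ (‖z‖ ^ 2) = 0 := fun z hz => hψ0 _ (by gcongr)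
  have hint1 : ∀ i, Integrable (fun z => fderiv ℝ X z (e i) * fderiv ℝ u z (e i)) μ := by
    intro i
    refine integrable_mul_of_continuousOn_ball μ hb ?_ ?_ (hdi i).continuousOn
    · simp only [hX'']
      fun_prop
    · intro z hz
      simp [hX'', hψn z hz]
  have hint2 : ∀ i, Integrable
      (fun z => X z * fderiv ℝ (fun y => fderiv ℝ u y (e i)) z (e i)) μ := fun i =>
    integrable_mul_of_continuousOn_ball μ hb hXc hX0 (hddi i)
  have hparts : ∀ i, ∫ z, X z * fderiv ℝ (fun y => fderiv ℝ u y (e i)) z (e i) ∂μ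
      = - ∫ z, fderiv ℝ X z (e i) * fderiv ℝ u z (e i) ∂μ := by
    intro i
    refine integral_mul_fderiv_eq_neg_fderiv_mul_of_integrable (hint1 i) (hint2 i)
      (integrable_mul_of_continuousOn_ball μ hb hXc hX0 (hdi i).continuousOn)
      (fun z _ => (hX' z).differentiableAt) fun z hz => ?_
    exact ((hdi i).differentiableOn (by norm_num)).differentiableAt
      (isOpen_ball.mem_nhds (htX hz))
  have hL : ∫ z, X z * Δ u z ∂μ
      = ∑ i, ∫ z, X z * fderiv ℝ (fun y => fderiv ℝ u y (e i)) z (e i) ∂μ := by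
    rw [← integral_finsetSum _ fun i _ => hint2 i]
    refine integral_congr_ae (Filter.Eventually.of_forall fun z => ?_)
    dsimp only
    by_cases hz : b ≤ ‖z‖
    · simp [hX0 z hz]
    · rw [laplacian_eq_sum_fderiv (hball z (by simp; linarith)), Finset.mul_sum]
  rw [hL, Finset.sum_congr rfl fun i _ => hparts i, Finset.sum_neg_distrib,
    ← integral_finsetSum _ fun i _ => hint1 i, ← integral_neg]
  refine integral_congr_ae (Filter.Eventually.of_forall fun z => ?_)
  dsimp only
  have hz : fderiv ℝ u z z = ∑ i, inner ℝ z (e i) * fderiv ℝ u z (e i) := by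
    generalize fderiv ℝ u z = T
    conv_lhs => rw [← e.sum_repr' z]
    simp [real_inner_comm]
  rw [hz, Finset.mul_sum, ← Finset.sum_neg_distrib]
  refine Finset.sum_congr rfl fun i _ => ?_
  rw [hX'']
  ring

end Green

/-! ### Spherical means of subharmonic functions. -/

section SphericalMeans

variable {E : Type*} [NormedAddCommGroup E] [InnerProductSpace ℝ E] [FiniteDimensional ℝ E]
  [MeasurableSpace E] [BorelSpace E] (μ : Measure E) [μ.IsAddHaarMeasure]

/-- The integral of the radial derivative of `u` over the sphere of radius `t`, with respect to
the surface measure of the unit sphere. -/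
noncomputable def radialFlux (u : E → ℝ) (t : ℝ) : ℝ :=
  ∫ ζ : sphere (0 : E) 1, fderiv ℝ u (t • (ζ : E)) ζ ∂μ.toSphere

/-- The unnormalized integral mean of `u` over the sphere of radius `t`. -/
noncomputable def sphereIntegral (u : E → ℝ) (t : ℝ) : ℝ :=
  ∫ ζ : sphere (0 : E) 1, u (t • (ζ : E)) ∂μ.toSphere

omit [FiniteDimensional ℝ E] [MeasurableSpace E] [BorelSpace E] in
theorem smul_sphere_mem_ball {R t : ℝ} (h0 : 0 ≤ t) (h1 : t < R) (ζ : sphere (0 : E) 1) :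
    t • (ζ : E) ∈ ball (0 : E) R := by
  simp [norm_smul, abs_of_nonneg h0, h1]

omit [FiniteDimensional ℝ E] [MeasurableSpace E] [BorelSpace E] in
theorem continuousOn_flux_integrand {R : ℝ} {u : E → ℝ} (hu : ContDiffOn ℝ 1 u (ball 0 R)) :
    ContinuousOn (fun x : ℝ × sphere (0 : E) 1 => fderiv ℝ u (x.1 • (x.2 : E)) x.2)
      (Ico 0 R ×ˢ univ) := by
  have hd : ContinuousOn (fderiv ℝ u) (ball 0 R) :=
    hu.continuousOn_fderiv_of_isOpen isOpen_ball (by norm_num)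
  refine ContinuousOn.clm_apply (hd.comp (by fun_prop) fun x hx => ?_) (by fun_prop)
  exact smul_sphere_mem_ball hx.1.1 hx.1.2 _

theorem continuousOn_radialFlux {R : ℝ} {u : E → ℝ} (hu : ContDiffOn ℝ 1 u (ball 0 R)) :
    ContinuousOn (radialFlux μ u) (Ico 0 R) :=
  continuousOn_integral_of_compact_support (k := univ) isCompact_univ
    (continuousOn_flux_integrand hu) (by simp)

theorem sphereIntegral_sub {R a b : ℝ} (ha : 0 ≤ a) (hab : a ≤ b) (hb : b < R) {u : E → ℝ}
    (hu : ContDiffOn ℝ 1 u (ball 0 R)) :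
    sphereIntegral μ u b - sphereIntegral μ u a = ∫ t in a..b, radialFlux μ u t := by
  have hsub : Icc a b ⊆ Ico 0 R := fun t ht => ⟨ha.trans ht.1, ht.2.trans_lt hb⟩
  have hcont : ∀ t ∈ Ico 0 R, Continuous fun ζ : sphere (0 : E) 1 => u (t • (ζ : E)) :=
    fun t ht => hu.continuousOn.comp_continuous (by fun_prop)
      fun ζ => smul_sphere_mem_ball ht.1 ht.2 ζ
  have hint : ∀ t ∈ Ico 0 R, Integrable (fun ζ : sphere (0 : E) 1 => u (t • (ζ : E))) μ.toSphere :=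
    fun t ht => (hcont t ht).integrable_of_hasCompactSupport (HasCompactSupport.of_compactSpace _)
  -- The fundamental theorem of calculus is applied on each ray; Fubini then exchanges the ray and
  -- the sphere.
  have hftc : ∀ ζ : sphere (0 : E) 1, u (b • (ζ : E)) - u (a • (ζ : E))
      = ∫ t in a..b, fderiv ℝ u (t • (ζ : E)) ζ := by
    intro ζ
    rw [intervalIntegral.integral_eq_sub_of_hasDerivAt (f := fun t => u (t • (ζ : E)))]
    · intro t ht
      rw [uIcc_of_le hab] at ht
      have h1 : DifferentiableAt ℝ u (t • (ζ : E)) :=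
        (hu.differentiableOn (by norm_num)).differentiableAt
          (isOpen_ball.mem_nhds (smul_sphere_mem_ball (hsub ht).1 (hsub ht).2 ζ))
      have h2 : HasDerivAt (fun t : ℝ => t • (ζ : E)) (ζ : E) t := by
        simpa using (hasDerivAt_id t).smul_const (ζ : E)
      exact h1.hasFDerivAt.comp_hasDerivAt t h2
    · refine ContinuousOn.intervalIntegrable ?_
      rw [uIcc_of_le hab]
      exact (continuousOn_flux_integrand hu).comp (f := fun t : ℝ => (t, ζ)) (by fun_prop)
        fun t ht => ⟨hsub ht, mem_univ _⟩
  rw [sphereIntegral, sphereIntegral, ← integral_sub (hint b (hsub ⟨hab, le_rfl⟩))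
    (hint a (hsub ⟨le_rfl, hab⟩)), integral_congr_ae (Filter.Eventually.of_forall hftc)]
  simp only [radialFlux, intervalIntegral.integral_of_le hab]
  rw [integral_integral_swap]
  have h3 : ContinuousOn (fun x : sphere (0 : E) 1 × ℝ => fderiv ℝ u (x.2 • (x.1 : E)) x.1)
      (univ ×ˢ Icc a b) :=
    (continuousOn_flux_integrand hu).comp (f := fun x : sphere (0 : E) 1 × ℝ => (x.2, x.1))
      (by fun_prop) fun x hx => ⟨hsub hx.2, mem_univ _⟩
  have h4 := h3.integrableOn_compact (μ := μ.toSphere.prod volume)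
    (isCompact_univ.prod isCompact_Icc)
  have h5 := h4.mono_set (prod_mono_right Ioc_subset_Icc_self)
  rw [IntegrableOn, ← Measure.prod_restrict, Measure.restrict_univ] at h5
  exact h5

theorem integrableOn_radial_test {R b : ℝ} (hb : b < R) {u : E → ℝ}
    (hu : ContDiffOn ℝ 1 u (ball 0 R)) {g : ℝ → ℝ} (hg : Continuous g)
    (hg0 : ∀ t, b ≤ t → g t = 0) :
    IntegrableOn (fun t => g t * radialFlux μ u t) (Ioi 0) := by
  have h1 : IntegrableOn (fun t => g t * radialFlux μ u t) (Icc 0 b) :=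
    (hg.continuousOn.mul ((continuousOn_radialFlux μ hu).mono
      fun t ht => ⟨ht.1, ht.2.trans_lt hb⟩)).integrableOn_compact isCompact_Icc
  refine (h1.mono_set Ioc_subset_Icc_self).of_forall_sdiff_eq_zero measurableSet_Ioi fun t ht => ?_
  have : b ≤ t := by
    by_contra h
    exact ht.2 ⟨ht.1, (not_le.1 h).le⟩
  simp [hg0 t this]

/-- Replaces the divergence theorem on balls: no integral over a sphere as a boundary is needed,
since the flux is seen only through continuous weights in the radius. -/
theorem integral_radial_mul_laplacian_eq_flux [Nontrivial E] {R b : ℝ} (hb0 : 0 ≤ b) (hb : b < R)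
    {u : E → ℝ} (hu : ContDiffOn ℝ 2 u (ball 0 R)) {ψ : ℝ → ℝ} (hψ : Continuous ψ)
    (hψ0 : ∀ s, b ^ 2 ≤ s → ψ s = 0) :
    ∫ z, (∫ s in (‖z‖ ^ 2)..(b ^ 2), ψ s) * Δ u z ∂μ
      = ∫ t in Ioi (0 : ℝ), (t ^ (Module.finrank ℝ E - 1) * (2 * ψ (t ^ 2) * t))
        * radialFlux μ u t := by
  have hd : ContinuousOn (fun z => fderiv ℝ u z z) (ball 0 R) :=
    (hu.continuousOn_fderiv_of_isOpen isOpen_ball (by norm_num)).clm_apply continuousOn_id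
  have hi : Integrable (fun z => (2 * ψ (‖z‖ ^ 2)) * fderiv ℝ u z z) μ :=
    integrable_mul_of_continuousOn_ball μ hb (by fun_prop)
      (fun z hz => by rw [hψ0 _ (by gcongr)]; simp) hd
  rw [integral_radial_mul_laplacian μ hb0 hb hu hψ hψ0, integral_polar μ _ hi]
  refine setIntegral_congr_fun measurableSet_Ioi fun t ht => ?_
  have ht' : |t| = t := abs_of_pos ht
  simp only [norm_smul, norm_eq_of_mem_sphere, Real.norm_eq_abs, mul_one, ht', map_smul,
    smul_eq_mul, radialFlux]
  simp only [integral_const_mul]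
  ring

/-- If the flux were negative at `t₀`, it would be so on a short interval by continuity. Green's
formula with a bump supported there would equate a nonnegative integral of `Δ u` with a strictly
negative one. -/
theorem radialFlux_nonneg [Nontrivial E] {R : ℝ} {u : E → ℝ} (hu : ContDiffOn ℝ 2 u (ball 0 R))
    (hsub : ∀ z ∈ ball (0 : E) R, 0 ≤ Δ u z) {t₀ : ℝ} (ht : t₀ ∈ Ioo 0 R) :
    0 ≤ radialFlux μ u t₀ := by
  by_contra! hneg
  have hu1 : ContDiffOn ℝ 1 u (ball 0 R) := hu.of_le (by norm_num)
  have hc := continuousOn_radialFlux μ hu1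
  have hev : ∀ᶠ t in 𝓝 t₀, t ∈ Ioo 0 R ∧ radialFlux μ u t < 0 :=
    Filter.Eventually.and (isOpen_Ioo.mem_nhds ht) ((hc.continuousAt (Ico_mem_nhds ht.1 ht.2)).eventually_lt_const hneg)
  obtain ⟨ε, hε, hball⟩ := Metric.eventually_nhds_iff_ball.1 hev
  set c := t₀ - ε / 2 with hcdef
  set d := t₀ + ε / 2 with hddef
  have hmem : ∀ t ∈ Icc c d, t ∈ Ioo 0 R ∧ radialFlux μ u t < 0 := fun t ht' =>
    hball t (by rw [Real.ball_eq_Ioo]; constructor <;> linarith [ht'.1, ht'.2])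
  have hcd : c < d := by linarith
  have hc0 : 0 < c := (hmem c ⟨le_rfl, hcd.le⟩).1.1
  have hdR : d < R := (hmem d ⟨hcd.le, le_rfl⟩).1.2
  -- The argument of `ψ` is a squared radius, so this bump is positive exactly for radii in `(c,
  -- d)`.
  set ψ : ℝ → ℝ := fun s => max 0 ((s - c ^ 2) * (d ^ 2 - s)) with hψdef
  have hψ : Continuous ψ := by fun_prop
  have hc2 : c ^ 2 < d ^ 2 := by gcongr
  have hψnn : ∀ s, 0 ≤ ψ s := fun s => le_max_left _ _
  have hψ0 : ∀ s, d ^ 2 ≤ s → ψ s = 0 := fun s hs =>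
    max_eq_left (mul_nonpos_of_nonneg_of_nonpos (by linarith) (by linarith))
  have hψ0' : ∀ s, s ≤ c ^ 2 → ψ s = 0 := fun s hs =>
    max_eq_left (mul_nonpos_of_nonpos_of_nonneg (by linarith) (by linarith))
  have hG := integral_radial_mul_laplacian_eq_flux μ (hc0.trans hcd).le hdR hu hψ hψ0
  have hL : 0 ≤ ∫ z, (∫ s in (‖z‖ ^ 2)..(d ^ 2), ψ s) * Δ u z ∂μ := by
    refine integral_nonneg fun z => ?_
    dsimp only
    by_cases hz : ‖z‖ < d
    · exact mul_nonneg (intervalIntegral.integral_nonneg (by gcongr) fun s _ => hψnn s)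
        (hsub z (by simpa using hz.trans hdR))
    · have hz2 : d ^ 2 ≤ ‖z‖ ^ 2 := by
        have := hc0.trans hcd
        gcongr
        exact not_lt.1 hz
      rw [intervalIntegral.integral_congr (g := fun _ => 0)]
      · simp
      · intro s hs
        rw [uIcc_of_ge hz2] at hs
        exact hψ0 s hs.1
  set g : ℝ → ℝ := fun t => t ^ (Module.finrank ℝ E - 1) * (2 * ψ (t ^ 2) * t) with hgdef
  have hg : Continuous g := by fun_prop
  have hres : ∫ t in Ioi (0 : ℝ), g t * radialFlux μ u t = ∫ t in c..d, g t * radialFlux μ u t := by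
    rw [intervalIntegral.integral_of_le hcd.le]
    refine setIntegral_eq_of_subset_of_forall_sdiff_eq_zero (s := Ioc c d) measurableSet_Ioi
      (fun t ht' => hc0.trans ht'.1) fun t ht' => ?_
    have : ψ (t ^ 2) = 0 := by
      have ht0 : 0 < t := ht'.1
      rcases le_or_gt t c with h | h
      · exact hψ0' _ (by gcongr)
      · have : d < t := by
          by_contra h2
          exact ht'.2 ⟨h, not_lt.1 h2⟩
        exact hψ0 _ (by have := hc0.trans hcd; gcongr)
    simp [hgdef, this]
  have hlt : 0 < ∫ t in c..d, -(g t * radialFlux μ u t) := by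
    refine intervalIntegral.intervalIntegral_pos_of_pos_on ?_ (fun t ht' => ?_) hcd
    · refine ContinuousOn.intervalIntegrable ?_
      rw [uIcc_of_le hcd.le]
      exact (hg.continuousOn.mul (hc.mono fun t ht' =>
        ⟨(hmem t ht').1.1.le, (hmem t ht').1.2⟩)).neg
    · have hh := (hmem t (Ioo_subset_Icc_self ht')).2
      have ht0 : 0 < t := hc0.trans ht'.1
      have h1 : c ^ 2 < t ^ 2 := by have := ht'.1; gcongr
      have h2 : t ^ 2 < d ^ 2 := by have := ht'.2; gcongr
      have hp : 0 < ψ (t ^ 2) := lt_max_of_lt_right (mul_pos (by linarith) (by linarith))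
      have : 0 < g t := by positivity
      nlinarith
  rw [intervalIntegral.integral_neg] at hlt
  rw [hG, hres] at hL
  linarith

theorem sphereIntegral_monotoneOn [Nontrivial E] {R : ℝ} {u : E → ℝ}
    (hu : ContDiffOn ℝ 2 u (ball 0 R)) (hsub : ∀ z ∈ ball (0 : E) R, 0 ≤ Δ u z) :
    MonotoneOn (sphereIntegral μ u) (Ico 0 R) := by
  intro a ha b hb hab
  have h := sphereIntegral_sub μ ha.1 hab hb.2 (hu.of_le (by norm_num))
  have h2 : 0 ≤ ∫ t in a..b, radialFlux μ u t := by
    rw [intervalIntegral.integral_of_le hab]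
    exact setIntegral_nonneg measurableSet_Ioc fun t ht =>
      radialFlux_nonneg μ hu hsub ⟨ha.1.trans_lt ht.1, ht.2.trans_lt hb.2⟩
  linarith

/-- The increment of the spherical mean from `a` to `r` is the integral of the flux. Green's formula
with a cutoff equal to 1 up to radius `r` dominates that integral, and its test function is at most
`2 (1 - ‖z‖)`. The bound does not depend on `r`. -/
theorem sphereIntegral_le_of_subharmonic [Nontrivial E] {u : E → ℝ}
    (hu : ContDiffOn ℝ 2 u (ball 0 1)) (hsub : ∀ z ∈ ball (0 : E) 1, 0 ≤ Δ u z)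
    (hint : IntegrableOn (fun z => (1 - ‖z‖) * Δ u z) (ball 0 1) μ) {a r : ℝ} (ha : 0 < a)
    (har : a ≤ r) (hr : r < 1) :
    sphereIntegral μ u r ≤ sphereIntegral μ u a + (a ^ (Module.finrank ℝ E - 1) * a)⁻¹ *
      ∫ z in ball (0 : E) 1, (1 - ‖z‖) * Δ u z ∂μ := by
  have hu1 : ContDiffOn ℝ 1 u (ball 0 1) := hu.of_le (by norm_num)
  set b := (1 + r) / 2 with hb
  have hrb : r < b := by linarith
  have hb1 : b < 1 := by linarith
  have hr0 : 0 < r := ha.trans_le har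
  have hb0 : 0 < b := hr0.trans hrb
  have hrb2 : r ^ 2 < b ^ 2 := by gcongr
  -- A continuous cutoff in the squared radius: 1 up to `r²`, then affine down to 0 at `b²`. The
  -- intermediate radius `b` leaves room for this below 1.
  set ψ : ℝ → ℝ := fun s => min 1 (max 0 ((b ^ 2 - s) / (b ^ 2 - r ^ 2))) with hψdef
  have hψ : Continuous ψ := by fun_prop
  have hψ1 : ∀ s, ψ s ≤ 1 := fun s => min_le_left _ _
  have hψnn : ∀ s, 0 ≤ ψ s := fun s => le_min zero_le_one (le_max_left _ _)
  have hψ0 : ∀ s, b ^ 2 ≤ s → ψ s = 0 := by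
    intro s hs
    have : (b ^ 2 - s) / (b ^ 2 - r ^ 2) ≤ 0 :=
      div_nonpos_of_nonpos_of_nonneg (by linarith) (by linarith)
    simp [hψdef, max_eq_left this]
  have hψr : ∀ s, s ≤ r ^ 2 → ψ s = 1 := by
    intro s hs
    refine min_eq_left (le_max_of_le_right ?_)
    rw [le_div_iff₀ (by linarith)]
    linarith
  have hG := integral_radial_mul_laplacian_eq_flux μ hb0.le hb1 hu hψ hψ0
  have hX0 : ∀ z : E, b ≤ ‖z‖ → ∫ s in (‖z‖ ^ 2)..(b ^ 2), ψ s = 0 := by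
    intro z hz
    have hz2 : b ^ 2 ≤ ‖z‖ ^ 2 := by gcongr
    rw [intervalIntegral.integral_congr (g := fun _ => 0)]
    · simp
    · intro s hs
      rw [uIcc_of_ge hz2] at hs
      exact hψ0 s hs.1
  have hL : ∫ z, (∫ s in (‖z‖ ^ 2)..(b ^ 2), ψ s) * Δ u z ∂μ
      ≤ 2 * ∫ z in ball (0 : E) 1, (1 - ‖z‖) * Δ u z ∂μ := by
    rw [← integral_const_mul, ← integral_indicator measurableSet_ball]
    refine integral_mono_of_nonneg (Filter.Eventually.of_forall fun z => ?_)
      ((integrable_indicator_iff measurableSet_ball).2 (hint.const_mul 2))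
      (Filter.Eventually.of_forall fun z => ?_)
    · dsimp only [Pi.zero_apply]
      by_cases hz : ‖z‖ < b
      · exact mul_nonneg (intervalIntegral.integral_nonneg (by gcongr) fun s _ => hψnn s)
          (hsub z (by simpa using hz.trans hb1))
      · rw [hX0 z (not_lt.1 hz), zero_mul]
    · dsimp only
      by_cases hz : ‖z‖ < b
      · have hz1 : z ∈ ball (0 : E) 1 := by simpa using hz.trans hb1
        rw [indicator_of_mem hz1, ← mul_assoc]
        refine mul_le_mul_of_nonneg_right ?_ (hsub z hz1)
        have hle : ‖z‖ ^ 2 ≤ b ^ 2 := by gcongr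
        -- The test function is at most `b² - ‖z‖² = (b - ‖z‖)(b + ‖z‖) ≤ 2 (1 - ‖z‖)`.
        have h1 : ∫ s in (‖z‖ ^ 2)..(b ^ 2), ψ s ≤ ∫ s in (‖z‖ ^ 2)..(b ^ 2), (1 : ℝ) :=
          intervalIntegral.integral_mono_on hle (hψ.intervalIntegrable _ _)
            (by simp) fun s _ => hψ1 s
        simp only [intervalIntegral.integral_const, smul_eq_mul, mul_one] at h1
        nlinarith [norm_nonneg z]
      · rw [hX0 z (not_lt.1 hz), zero_mul]
        refine indicator_nonneg (fun w hw => ?_) z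
        have : ‖w‖ < 1 := by simpa using hw
        exact mul_nonneg zero_le_two (mul_nonneg (by linarith) (hsub w hw))
  set g : ℝ → ℝ := fun t => t ^ (Module.finrank ℝ E - 1) * (2 * ψ (t ^ 2) * t) with hgdef
  have hg : Continuous g := by fun_prop
  have hg0 : ∀ t, b ≤ t → g t = 0 := fun t ht => by
    simp [hgdef, hψ0 (t ^ 2) (by gcongr)]
  have hgi := integrableOn_radial_test μ hb1 hu1 hg hg0
  have hflux : ∀ t ∈ Ioo (0 : ℝ) 1, 0 ≤ radialFlux μ u t := fun t ht =>
    radialFlux_nonneg μ hu hsub ht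
  set A := a ^ (Module.finrank ℝ E - 1) * a with hA
  have hA0 : 0 < A := by positivity
  -- On `(a, r]` the weight `g` is at least `2 * A`; elsewhere the integrand is nonnegative and may
  -- be discarded.
  have hlow : 2 * A * (sphereIntegral μ u r - sphereIntegral μ u a)
      ≤ ∫ t in Ioi (0 : ℝ), g t * radialFlux μ u t := by
    rw [sphereIntegral_sub μ ha.le har hr hu1, intervalIntegral.integral_of_le har,
      ← integral_const_mul]
    have hsubset : Ioc a r ⊆ Ioi (0 : ℝ) := fun t ht => ha.trans ht.1
    refine (setIntegral_mono_on ?_ (hgi.mono_set hsubset) measurableSet_Ioc fun t ht => ?_).trans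
      (setIntegral_mono_set hgi ?_ hsubset.eventuallyLE)
    · refine Integrable.const_mul ?_ _
      exact (((continuousOn_radialFlux μ hu1).mono fun t ht =>
        ⟨ha.le.trans ht.1, ht.2.trans_lt hr⟩).integrableOn_compact
          (isCompact_Icc (a := a) (b := r))).mono_set Ioc_subset_Icc_self
    · refine mul_le_mul_of_nonneg_right ?_ (hflux t ⟨ha.trans ht.1, ht.2.trans_lt hr⟩)
      have ht0 : 0 < t := ha.trans ht.1
      have : ψ (t ^ 2) = 1 := hψr _ (by have := ht.2; gcongr)
      simp only [hgdef, this, hA]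
      have h3 : a ^ (Module.finrank ℝ E - 1) * a ≤ t ^ (Module.finrank ℝ E - 1) * t := by
        have := ht.1.le
        gcongr
      linarith
    · refine (ae_restrict_mem measurableSet_Ioi).mono fun t ht => ?_
      have ht0 : 0 < t := ht
      dsimp only [Pi.zero_apply]
      rcases lt_or_ge t b with h | h
      · have := hψnn (t ^ 2)
        exact mul_nonneg (by positivity) (hflux t ⟨ht, h.trans hb1⟩)
      · simp [hg0 t h]
  rw [← hG] at hlow
  have h5 := hlow.trans hL
  have h6 : sphereIntegral μ u r - sphereIntegral μ u a
      ≤ A⁻¹ * ∫ z in ball (0 : E) 1, (1 - ‖z‖) * Δ u z ∂μ := by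
    rw [inv_mul_eq_div, le_div_iff₀ hA0]
    linarith
  linarith

theorem measurable_indicator_of_continuousOn {X Y : Type*} [TopologicalSpace X]
    [MeasurableSpace X] [OpensMeasurableSpace X] [TopologicalSpace Y] [MeasurableSpace Y]
    [BorelSpace Y] [Zero Y] {s : Set X} (hs : MeasurableSet s) {f : X → Y}
    (hf : ContinuousOn f s) : Measurable (s.indicator f) := by
  classical
  have := hf.measurable_piecewise (continuousOn_const (c := (0 : Y))) hs
  rwa [← Set.piecewise_eq_indicator]

/-- The sub-mean value property over a solid ball: monotone spherical means exceed their value at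
radius 0, and polar coordinates integrate this over the radius. -/
theorem mul_measure_ball_le_lintegral [Nontrivial E] {R : ℝ} {u : E → ℝ}
    (hu : ContDiffOn ℝ 2 u (ball 0 R)) (hsub : ∀ z ∈ ball (0 : E) R, 0 ≤ Δ u z)
    (hnn : ∀ z ∈ ball (0 : E) R, 0 ≤ u z) :
    ENNReal.ofReal (u 0) * μ (ball 0 R) ≤ ∫⁻ z in ball (0 : E) R, ENNReal.ofReal (u z) ∂μ := by
  have hm : Measurable ((ball (0 : E) R).indicator fun z => ENNReal.ofReal (u z)) :=
    measurable_indicator_of_continuousOn measurableSet_ball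
      (ENNReal.continuous_ofReal.comp_continuousOn hu.continuousOn)
  rw [← setLIntegral_const, ← lintegral_indicator measurableSet_ball,
    ← lintegral_indicator measurableSet_ball,
    lintegral_polar μ _ (measurable_const.indicator measurableSet_ball), lintegral_polar μ _ hm]
  refine setLIntegral_mono' measurableSet_Ioi fun t ht => ?_
  have ht0 : 0 < t := ht
  refine mul_le_mul_right ?_ _
  by_cases htR : t < R
  · have hin := fun ζ : sphere (0 : E) 1 => smul_sphere_mem_ball (E := E) ht0.le htR ζ
    rw [lintegral_congr fun ζ => indicator_of_mem (hin ζ) _,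
      lintegral_congr fun ζ => indicator_of_mem (hin ζ) _]
    have hcont : Continuous fun ζ : sphere (0 : E) 1 => u (t • (ζ : E)) :=
      hu.continuousOn.comp_continuous (by fun_prop) hin
    rw [← ofReal_integral_eq_lintegral_ofReal
      (hcont.integrable_of_hasCompactSupport (HasCompactSupport.of_compactSpace _))
      (Filter.Eventually.of_forall fun ζ => hnn _ (hin ζ)),
      ← ofReal_integral_eq_lintegral_ofReal (integrable_const _)
      (Filter.Eventually.of_forall fun ζ => hnn 0 (by simp; linarith))]
    refine ENNReal.ofReal_le_ofReal ?_
    have := sphereIntegral_monotoneOn μ hu hsub (a := 0) ⟨le_rfl, ht0.trans htR⟩ ⟨ht0.le, htR⟩ ht0.le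
    simpa [sphereIntegral] using this
  · have hout : ∀ ζ : sphere (0 : E) 1, t • (ζ : E) ∉ ball (0 : E) R := fun ζ => by
      simpa [norm_smul, abs_of_pos ht0] using htR
    rw [lintegral_congr fun ζ => indicator_of_notMem (hout ζ) _,
      lintegral_congr fun ζ => indicator_of_notMem (hout ζ) _]

omit [MeasurableSpace E] [BorelSpace E] in
theorem laplacian_comp_add_left {F : Type*} [NormedAddCommGroup F] [NormedSpace ℝ F] (u : E → F)
    (a z : E) : Δ (fun w => u (a + w)) z = Δ u (a + z) := by
  simp [InnerProductSpace.laplacian_eq_iteratedFDeriv_stdOrthonormalBasis,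
    iteratedFDeriv_comp_add_left]

theorem mul_measure_ball_le_lintegral_center [Nontrivial E] {R : ℝ} {u : E → ℝ} {a : E}
    (hu : ContDiffOn ℝ 2 u (ball a R)) (hsub : ∀ z ∈ ball a R, 0 ≤ Δ u z)
    (hnn : ∀ z ∈ ball a R, 0 ≤ u z) :
    ENNReal.ofReal (u a) * μ (ball a R) ≤ ∫⁻ z in ball a R, ENNReal.ofReal (u z) ∂μ := by
  have hmem : ∀ z, a + z ∈ ball a R ↔ z ∈ ball (0 : E) R := fun z => by simp
  have h := mul_measure_ball_le_lintegral μ (R := R) (u := fun w => u (a + w))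
    (hu.comp (by fun_prop) fun z hz => (hmem z).2 hz)
    (fun z hz => by rw [laplacian_comp_add_left]; exact hsub _ ((hmem z).2 hz))
    fun z hz => hnn _ ((hmem z).2 hz)
  rw [← lintegral_indicator measurableSet_ball] at h ⊢
  rw [← lintegral_add_left_eq_self _ a]
  have h2 : ∀ z, (ball a R).indicator (fun z => ENNReal.ofReal (u z)) (a + z)
      = (ball (0 : E) R).indicator (fun z => ENNReal.ofReal (u (a + z))) z := fun z => by
    by_cases hz : z ∈ ball (0 : E) R
    · rw [indicator_of_mem hz, indicator_of_mem ((hmem z).2 hz)]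
    · rw [indicator_of_notMem hz, indicator_of_notMem (mt (hmem z).1 hz)]
  simp only [h2]
  simpa [Measure.addHaar_ball_center μ a R] using h

end SphericalMeans

/-! ### Calculus of the Laplacian. -/

section LaplacianCalculus

variable {E F : Type*} [NormedAddCommGroup E] [InnerProductSpace ℝ E] [FiniteDimensional ℝ E]

omit [FiniteDimensional ℝ E] in
theorem eventually_differentiableAt_fderiv [NormedAddCommGroup F] [NormedSpace ℝ F]
    {w : E → F} {x : E} (hw : ContDiffAt ℝ 2 w x) :
    ∀ᶠ y in 𝓝 x, DifferentiableAt ℝ w y ∧ DifferentiableAt ℝ (fderiv ℝ w) y :=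
  (hw.eventually (by simp)).mono fun y hy =>
    ⟨hy.differentiableAt (by norm_num),
      (hy.fderiv_right (m := 1) (by norm_num)).differentiableAt (by norm_num)⟩

theorem laplacian_norm_sq [NormedAddCommGroup F] [InnerProductSpace ℝ F] {w : E → F} {x : E}
    (hw : ContDiffAt ℝ 2 w x) :
    Δ (fun y => ‖w y‖ ^ 2) x
      = 2 * ∑ i, ‖fderiv ℝ w x (stdOrthonormalBasis ℝ E i)‖ ^ 2 + 2 * inner ℝ (w x) (Δ w x) := by
  have hev := eventually_differentiableAt_fderiv hw
  rw [laplacian_eq_sum_fderiv (hw.norm_sq ℝ), laplacian_eq_sum_fderiv hw, inner_sum,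
    Finset.mul_sum, Finset.mul_sum, ← Finset.sum_add_distrib]
  refine Finset.sum_congr rfl fun i _ => ?_
  set v := stdOrthonormalBasis ℝ E i
  have h1 : (fun y => fderiv ℝ (fun y => ‖w y‖ ^ 2) y v)
      =ᶠ[𝓝 x] fun y => 2 * inner ℝ (w y) (fderiv ℝ w y v) := by
    filter_upwards [hev] with y hy
    rw [hy.1.hasFDerivAt.norm_sq.fderiv]
    simp
  have hd : HasFDerivAt (fun y => fderiv ℝ w y v) (fderiv ℝ (fun y => fderiv ℝ w y v) x) x :=
    (hev.self_of_nhds.2.clm_apply (differentiableAt_const v)).hasFDerivAt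
  rw [h1.fderiv_eq, ((hev.self_of_nhds.1.hasFDerivAt.inner ℝ hd).const_mul 2).fderiv]
  simp
  ring

theorem laplacian_comp_real {u : E → ℝ} {x : E} (hu : ContDiffAt ℝ 2 u x) {G G' : ℝ → ℝ} {G'' : ℝ}
    (hG : ContDiffAt ℝ 2 G (u x)) (hG' : ∀ᶠ s in 𝓝 (u x), HasDerivAt G (G' s) s)
    (hG'' : HasDerivAt G' G'' (u x)) :
    Δ (fun y => G (u y)) x = G' (u x) * Δ u x
      + G'' * ∑ i, (fderiv ℝ u x (stdOrthonormalBasis ℝ E i)) ^ 2 := by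
  have hev := eventually_differentiableAt_fderiv hu
  rw [laplacian_eq_sum_fderiv (u := fun y => G (u y)) (hG.comp x hu), laplacian_eq_sum_fderiv hu,
    Finset.mul_sum, Finset.mul_sum, ← Finset.sum_add_distrib]
  refine Finset.sum_congr rfl fun i _ => ?_
  set v := stdOrthonormalBasis ℝ E i
  have h1 : (fun y => fderiv ℝ (fun y => G (u y)) y v)
      =ᶠ[𝓝 x] fun y => G' (u y) * fderiv ℝ u y v := by
    filter_upwards [hev, hu.continuousAt.eventually hG'] with y hy hy2
    have := hy2.comp_hasFDerivAt y hy.1.hasFDerivAt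
    change fderiv ℝ (G ∘ u) y v = _
    rw [this.fderiv]
    simp
  have hd : HasFDerivAt (fun y => fderiv ℝ u y v) (fderiv ℝ (fun y => fderiv ℝ u y v) x) x :=
    (hev.self_of_nhds.2.clm_apply (differentiableAt_const v)).hasFDerivAt
  have hc : HasFDerivAt (fun y => G' (u y)) (G'' • fderiv ℝ u x) x :=
    hG''.comp_hasFDerivAt x hev.self_of_nhds.1.hasFDerivAt
  rw [h1.fderiv_eq, (hc.fun_mul hd).fderiv]
  simp
  ring

omit [FiniteDimensional ℝ E] in
theorem fderiv_fderiv_apply_comm [NormedAddCommGroup F] [NormedSpace ℝ F] {w : E → F} {x : E}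
    (hw : ContDiffAt ℝ 2 w x) (a b : E) :
    fderiv ℝ (fun y => fderiv ℝ w y a) x b = fderiv ℝ (fun y => fderiv ℝ w y b) x a := by
  have hd := (eventually_differentiableAt_fderiv hw).self_of_nhds.2
  rw [fderiv_clm_apply hd (differentiableAt_const _),
    fderiv_clm_apply hd (differentiableAt_const _)]
  simpa using (hw.isSymmSndFDerivAt (by simp)).eq b a

/-- The direction `v` is moved outward past two basis directions by two uses of the symmetry of
second derivatives. This is where three derivatives are needed. -/
theorem laplacian_fderiv_apply [NormedAddCommGroup F] [NormedSpace ℝ F] {w : E → F} {x : E}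
    (hw : ContDiffAt ℝ 3 w x) (v : E) :
    Δ (fun y => fderiv ℝ w y v) x = fderiv ℝ (Δ w) x v := by
  have hev : ∀ᶠ y in 𝓝 x, ContDiffAt ℝ 3 w y := hw.eventually (by simp)
  have hev2 : ∀ᶠ y in 𝓝 x, ContDiffAt ℝ 2 w y := hev.mono fun y hy => hy.of_le (by norm_num)
  have hd : ∀ a, ContDiffAt ℝ 2 (fun y => fderiv ℝ w y a) x := fun a =>
    (hw.fderiv_right (m := 2) (by norm_num)).clm_apply contDiffAt_const
  have hL : Δ w =ᶠ[𝓝 x] fun y => ∑ i, fderiv ℝ (fun y => fderiv ℝ w y (stdOrthonormalBasis ℝ E i))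
      y (stdOrthonormalBasis ℝ E i) := hev2.mono fun y hy => laplacian_eq_sum_fderiv hy
  rw [laplacian_eq_sum_fderiv (hd v), hL.fderiv_eq, fderiv_fun_sum]
  · simp only [FunLike.coe_sum, Finset.sum_apply]
    refine Finset.sum_congr rfl fun i _ => ?_
    set e := stdOrthonormalBasis ℝ E i
    have h1 : (fun y => fderiv ℝ (fun y => fderiv ℝ w y v) y e)
        =ᶠ[𝓝 x] fun y => fderiv ℝ (fun y => fderiv ℝ w y e) y v :=
      hev2.mono fun y hy => fderiv_fderiv_apply_comm hy v e
    rw [h1.fderiv_eq, fderiv_fderiv_apply_comm (hd e)]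
  · intro i _
    exact (eventually_differentiableAt_fderiv (hd _)).self_of_nhds.2.clm_apply
      (differentiableAt_const _)

end LaplacianCalculus

/-! ### Subharmonicity from the Yukawa equation. -/

section Yukawa

variable {E : Type*} [NormedAddCommGroup E] [InnerProductSpace ℝ E] [FiniteDimensional ℝ E]
  {τ η : ℝ} {f : E → ℂ}

theorem inner_yukawa (τ η : ℝ) (w : ℂ) :
    inner ℝ w ((τ : ℂ) * w + (η : ℂ) * (w.re : ℂ)) = τ * ‖w‖ ^ 2 + η * w.re ^ 2 := by
  rw [Complex.inner, ← Complex.normSq_eq_norm_sq, Complex.normSq_apply]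
  simp
  ring

/-- Differentiating the equation along `v` reproduces it for the derivative, since `w ↦ τ w + η Re
w` is real-linear. Its inner product with `w` is `τ |w|² + η (Re w)² ≥ 0`. -/
theorem laplacian_norm_sq_fderiv_nonneg (hτ : 0 ≤ τ) (hη : 0 ≤ η) {x : E}
    (hf : ContDiffAt ℝ 3 f x)
    (hY : ∀ᶠ y in 𝓝 x, Δ f y = (τ : ℂ) * f y + (η : ℂ) * ((f y).re : ℂ)) (v : E) :
    0 ≤ Δ (fun y => ‖fderiv ℝ f y v‖ ^ 2) x := by
  have hd : ContDiffAt ℝ 2 (fun y => fderiv ℝ f y v) x :=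
    (hf.fderiv_right (m := 2) (by norm_num)).clm_apply contDiffAt_const
  have hfd : HasFDerivAt f (fderiv ℝ f x) x := (hf.differentiableAt (by norm_num)).hasFDerivAt
  have h2 : HasFDerivAt (fun y => ((f y).re : ℂ))
      ((Complex.ofRealCLM.comp Complex.reCLM).comp (fderiv ℝ f x)) x :=
    (Complex.ofRealCLM.comp Complex.reCLM).hasFDerivAt.comp x hfd
  have h3 : fderiv ℝ (Δ f) x v
      = (τ : ℂ) * fderiv ℝ f x v + (η : ℂ) * ((fderiv ℝ f x v).re : ℂ) := by
    rw [Filter.EventuallyEq.fderiv_eq hY,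
      ((hfd.const_mul (τ : ℂ)).fun_add (h2.const_mul (η : ℂ))).fderiv]
    simp
  rw [laplacian_norm_sq hd, laplacian_fderiv_apply hf, h3, inner_yukawa]
  positivity

theorem sum_norm_fderiv_sq_le (x : E) :
    ∑ i, ‖fderiv ℝ f x (stdOrthonormalBasis ℝ E i)‖ ^ 2
      ≤ Module.finrank ℝ E * ‖fderiv ℝ f x‖ ^ 2 := by
  have h : ∀ i ∈ Finset.univ, ‖fderiv ℝ f x (stdOrthonormalBasis ℝ E i)‖ ^ 2
      ≤ ‖fderiv ℝ f x‖ ^ 2 := fun i _ => by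
    have := (fderiv ℝ f x).le_opNorm (stdOrthonormalBasis ℝ E i)
    rw [(stdOrthonormalBasis ℝ E).norm_eq_one, mul_one] at this
    gcongr
  simpa using Finset.sum_le_card_nsmul _ _ _ h

/-- The smooth substitute `(1 + |f|²)^{p/2}` for `|f|^p`. -/
noncomputable def regPow {E : Type*} (p : ℝ) (f : E → ℂ) (x : E) : ℝ := (1 + ‖f x‖ ^ 2) ^ (p / 2)

omit [FiniteDimensional ℝ E] in
theorem contDiffAt_regPow (p : ℝ) {x : E} (hf : ContDiffAt ℝ 2 f x) :
    ContDiffAt ℝ 2 (regPow p f) x :=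
  (contDiffAt_const.add (hf.norm_sq ℝ)).rpow_const_of_ne (by positivity)

/-- With `u = |f|²` and `G(s) = (1 + s)^{p/2}`, the chain rule gives `G'(u) Δu + G''(u) |∇u|²`, and
both terms are nonnegative as `p ≥ 2`. The upper bound uses `|∇u|² ≤ 4 u |Df|²` (Cauchy–Schwarz).
Adding 1 to `u` removes the singularity at zeros of `f`. -/
theorem laplacian_regPow_bounds (hτ : 0 ≤ τ) (hη : 0 ≤ η) {p : ℝ} (hp : 2 ≤ p) {x : E}
    (hf : ContDiffAt ℝ 2 f x) (hY : Δ f x = (τ : ℂ) * f x + (η : ℂ) * ((f x).re : ℂ)) :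
    0 ≤ Δ (regPow p f) x ∧ Δ (regPow p f) x
      ≤ p * (p - 1) * Module.finrank ℝ E * (regPow (p - 2) f x * ‖fderiv ℝ f x‖ ^ 2)
        + p * (τ + η) * regPow p f x := by
  set u : E → ℝ := fun y => ‖f y‖ ^ 2 with hu
  have hu2 : ContDiffAt ℝ 2 u x := hf.norm_sq ℝ
  have hux : 0 ≤ u x := by positivity
  have hpos : ∀ᶠ s in 𝓝 (u x), 0 < 1 + s :=
    (lt_mem_nhds (show -1 < u x by linarith)).mono fun s hs => by linarith
  have hder : ∀ r s : ℝ, 0 < 1 + s → HasDerivAt (fun s => (1 + s) ^ r) (r * (1 + s) ^ (r - 1)) s := by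
    intro r s hs
    have h := ((hasDerivAt_id s).const_add 1).rpow_const (p := r) (Or.inl hs.ne')
    simpa using h
  have hx1 : 0 < 1 + u x := by linarith
  have hL := laplacian_comp_real (G := fun s => (1 + s) ^ (p / 2))
    (G' := fun s => p / 2 * (1 + s) ^ (p / 2 - 1)) hu2
    ((contDiffAt_const.add contDiffAt_id).rpow_const_of_ne hx1.ne')
    (hpos.mono fun s hs => hder _ s hs) ((hder (p / 2 - 1) _ hx1).const_mul (p / 2))
  have hinner := inner_yukawa τ η (f x)
  have hLu : Δ u x = 2 * ∑ i, ‖fderiv ℝ f x (stdOrthonormalBasis ℝ E i)‖ ^ 2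
      + 2 * (τ * ‖f x‖ ^ 2 + η * (f x).re ^ 2) := by
    rw [hu, laplacian_norm_sq hf, hY, hinner]
  have hre : (f x).re ^ 2 ≤ u x := by
    rw [hu]
    exact sq_le_sq' (by linarith [neg_abs_le (f x).re, Complex.abs_re_le_norm (f x)])
      ((le_abs_self _).trans (Complex.abs_re_le_norm (f x)))
  set S := ∑ i, ‖fderiv ℝ f x (stdOrthonormalBasis ℝ E i)‖ ^ 2 with hS
  set M := (Module.finrank ℝ E : ℝ) * ‖fderiv ℝ f x‖ ^ 2 with hM
  have hSM : S ≤ M := sum_norm_fderiv_sq_le x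
  have hS0 : 0 ≤ S := by positivity
  have hM0 : 0 ≤ M := by positivity
  have hLu0 : 0 ≤ Δ u x := by rw [hLu]; positivity
  have hLu1 : Δ u x ≤ 2 * M + 2 * (τ + η) * u x := by
    rw [hLu]
    nlinarith [mul_le_mul_of_nonneg_left hre hη]
  set T := ∑ i, (fderiv ℝ u x (stdOrthonormalBasis ℝ E i)) ^ 2 with hT
  have hT0 : 0 ≤ T := by positivity
  have hTS : T ≤ 4 * u x * S := by
    rw [hT, hS, Finset.mul_sum]
    refine Finset.sum_le_sum fun i _ => ?_
    have h1 : fderiv ℝ u x (stdOrthonormalBasis ℝ E i)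
        = 2 * inner ℝ (f x) (fderiv ℝ f x (stdOrthonormalBasis ℝ E i)) := by
      rw [hu, (hf.differentiableAt (by norm_num)).hasFDerivAt.norm_sq.fderiv]
      simp
      ring
    have h2 := abs_real_inner_le_norm (f x) (fderiv ℝ f x (stdOrthonormalBasis ℝ E i))
    rw [h1, mul_pow, ← sq_abs (inner ℝ _ _)]
    have h3 : |inner ℝ (f x) (fderiv ℝ f x (stdOrthonormalBasis ℝ E i))| ^ 2
      ≤ (‖f x‖ * ‖fderiv ℝ f x (stdOrthonormalBasis ℝ E i)‖) ^ 2 := by gcongr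
    rw [hu]
    nlinarith
  change Δ (regPow p f) x = _ at hL
  have e1 : (1 + u x) ^ (p / 2) = (1 + u x) * (1 + u x) ^ (p / 2 - 1) := by
    rw [← Real.rpow_one_add' hx1.le (by linarith)]
    ring_nf
  have e2 : (1 + u x) ^ (p / 2 - 1) = (1 + u x) * (1 + u x) ^ (p / 2 - 1 - 1) := by
    nth_rewrite 2 [← Real.rpow_one (1 + u x)]
    rw [← Real.rpow_add hx1]
    ring_nf
  set A := (1 + u x) ^ (p / 2 - 1) with hA
  set B := (1 + u x) ^ (p / 2 - 1 - 1) with hB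
  have hA0 : 0 ≤ A := by positivity
  have hB0 : 0 ≤ B := by positivity
  have hp1 : 0 ≤ p / 2 - 1 := by linarith
  have e3 : regPow (p - 2) f x = A := by
    rw [regPow, hA, hu]
    ring_nf
  have e4 : regPow p f x = (1 + u x) * A := e1
  rw [hL, e3, e4]
  constructor
  · positivity
  · have hp0 : 0 ≤ p / 2 := by linarith
    -- The first-derivative term contributes `p` to the coefficient of `A * M` and the
    -- second-derivative term `p * (p - 2)`, in total `p * (p - 1)`.
    have k1 : p / 2 * A * Δ u x ≤ p / 2 * A * (2 * M + 2 * (τ + η) * u x) := by gcongr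
    have k2 : p / 2 * ((p / 2 - 1) * B) * T ≤ p / 2 * ((p / 2 - 1) * B) * (4 * u x * M) := by
      have : T ≤ 4 * u x * M := hTS.trans (by gcongr)
      gcongr
    have k3 : p / 2 * ((p / 2 - 1) * B) * (4 * u x * M) ≤ p * (p - 2) * (A * M) := by
      have : B * u x ≤ A := by rw [e2]; linarith
      have h4 : p / 2 * ((p / 2 - 1) * B) * (4 * u x * M) = p * (p - 2) * M * (B * u x) := by ring
      have h5 : 0 ≤ p * (p - 2) * M := by
        have : 0 ≤ p - 2 := by linarith
        positivity
      rw [h4]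
      exact (mul_le_mul_of_nonneg_left this h5).trans_eq (by ring)
    have k4 : p * (τ + η) * (A * u x) ≤ p * (τ + η) * ((1 + u x) * A) := by
      refine mul_le_mul_of_nonneg_left ?_ (by positivity)
      linarith
    have k5 : p * (p - 1) * Module.finrank ℝ E * (A * ‖fderiv ℝ f x‖ ^ 2)
        = p * (p - 1) * (A * M) := by rw [hM]; ring
    rw [k5]
    linarith

end Yukawa

/-- Takes the place of Hölder's inequality in passing from exponent 2 to `α`. Either `x² ≤ l`, or
`x^α = x² (x²)^{α/2-1} ≥ x² l^{α/2-1}`. The level `l` is free, to be chosen by scaling. -/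
theorem sq_le_add_rpow_mul_rpow {x l α : ℝ} (hx : 0 ≤ x) (hl : 0 < l) (hα : 2 ≤ α) :
    x ^ 2 ≤ l + l ^ (1 - α / 2) * x ^ α := by
  rcases le_or_gt (x ^ 2) l with h | h
  · have : 0 ≤ l ^ (1 - α / 2) * x ^ α := by positivity
    linarith
  · have hx2 : 0 < x ^ 2 := hl.trans h
    have h1 : x ^ α = x ^ 2 * (x ^ 2) ^ (α / 2 - 1) := by
      rw [← Real.rpow_natCast, ← Real.rpow_mul hx, ← Real.rpow_add' hx (by push_cast; linarith)]
      congr 1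
      push_cast
      ring
    have h2 : l ^ (α / 2 - 1) ≤ (x ^ 2) ^ (α / 2 - 1) :=
      Real.rpow_le_rpow hl.le h.le (by linarith)
    have h3 : l ^ (1 - α / 2) * l ^ (α / 2 - 1) = 1 := by
      rw [← Real.rpow_add hl]
      simp
    have h4 : x ^ 2 * 1 ≤ x ^ 2 * (l ^ (1 - α / 2) * (x ^ 2) ^ (α / 2 - 1)) := by
      refine mul_le_mul_of_nonneg_left (h3.symm.le.trans ?_) hx2.le
      gcongr
    rw [h1]
    calc x ^ 2 = x ^ 2 * 1 := (mul_one _).symm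
      _ ≤ _ := h4
      _ = l ^ (1 - α / 2) * (x ^ 2 * (x ^ 2) ^ (α / 2 - 1)) := by ring
      _ ≤ _ := by linarith

/-! ### Growth estimates and the bound on spherical means. -/

section Growth

variable {E : Type*} [NormedAddCommGroup E] [InnerProductSpace ℝ E] [FiniteDimensional ℝ E]
  [MeasurableSpace E] [BorelSpace E] [Nontrivial E] (μ : Measure E) [μ.IsAddHaarMeasure]
  {τ η α γ q : ℝ} {f : E → ℂ}

theorem exists_norm_fderiv_le (hτ : 0 ≤ τ) (hη : 0 ≤ η) (hα : 2 ≤ α) (hγ : 0 ≤ γ)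
    (hq : q = (Module.finrank ℝ E + γ) / α - 1) (hf : ContDiffOn ℝ 3 f (ball 0 1))
    (hY : ∀ z ∈ ball (0 : E) 1, Δ f z = (τ : ℂ) * f z + (η : ℂ) * ((f z).re : ℂ))
    (hK : IntegrableOn (fun z => (1 - ‖z‖) ^ γ * ‖fderiv ℝ f z‖ ^ α) (ball 0 1) μ) :
    ∃ C, 0 ≤ C ∧ ∀ z ∈ ball (0 : E) 1, ‖fderiv ℝ f z‖ ≤ C * (1 - ‖z‖) ^ (-(q + 1)) := by
  set K := ∫ z in ball (0 : E) 1, (1 - ‖z‖) ^ γ * ‖fderiv ℝ f z‖ ^ α ∂μ with hKdef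
  set ω := μ.real (ball (0 : E) 1) with hω
  set m := Module.finrank ℝ E with hm
  have hω0 : 0 < ω := ENNReal.toReal_pos (measure_ball_pos μ 0 one_pos).ne' measure_ball_lt_top.ne
  have hnn : ∀ z ∈ ball (0 : E) 1, 0 ≤ (1 - ‖z‖) ^ γ * ‖fderiv ℝ f z‖ ^ α := fun z hz => by
    have : ‖z‖ < 1 := by simpa using hz
    have : 0 ≤ 1 - ‖z‖ := by linarith
    positivity
  have hK0 : 0 ≤ K := setIntegral_nonneg measurableSet_ball hnn
  have hqα : (q + 1) * α = m + γ := by rw [hq]; field_simp; ring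
  refine ⟨√(1 + K / ω) * 2 ^ (q + 1), by positivity, fun z hz => ?_⟩
  have hz1 : ‖z‖ < 1 := by simpa using hz
  -- Half the distance to the sphere, so that `1 - ‖y‖ ≥ ρ` throughout `ball z ρ`.
  set ρ := (1 - ‖z‖) / 2 with hρ
  have hρ0 : 0 < ρ := by rw [hρ]; linarith
  have hball : ∀ y ∈ ball z ρ, ρ ≤ 1 - ‖y‖ := fun y hy => by
    have h1 : ‖y - z‖ < ρ := by simpa [dist_eq_norm] using hy
    have h2 := norm_le_norm_add_norm_sub' y z
    linarith
  have hsubset : ball z ρ ⊆ ball 0 1 := fun y hy => by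
    have := hball y hy
    simp
    linarith
  -- The operator norm is tested on one unit vector at a time, because the subharmonic functions
  -- available are the squared directional derivatives.
  have hbound : ‖fderiv ℝ f z‖ ≤ √(1 + K / ω) * ρ ^ (-(q + 1)) := by
    refine ContinuousLinearMap.opNorm_le_of_unit_norm (by positivity) fun v hv => ?_
    set u : E → ℝ := fun y => ‖fderiv ℝ f y v‖ ^ 2 with hu
    have hu2 : ContDiffOn ℝ 2 u (ball z ρ) := by
      refine ContDiffOn.norm_sq ℝ ?_
      exact ((hf.fderiv_of_isOpen (m := 2) isOpen_ball (by norm_num)).mono hsubset).clm_apply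
        contDiffOn_const
    have hmean := mul_measure_ball_le_lintegral_center μ hu2 (fun y hy => by
      have hy1 := hsubset hy
      have hnhds := isOpen_ball.mem_nhds hy1
      exact laplacian_norm_sq_fderiv_nonneg hτ hη (hf.contDiffAt hnhds)
        (Filter.eventually_of_mem hnhds hY) v) (fun y _ => by positivity)
    -- The square of the expected bound on the derivative. With this level, `(q + 1) * α = m + γ`
    -- turns `A` into `l * ρ ^ m`, which balances the volume `ρ ^ m * ω` of the ball.
    set l := ρ ^ (-(2 * (q + 1))) with hl
    have hl0 : 0 < l := by positivity
    set A := l ^ (1 - α / 2) * ρ ^ (-γ) with hA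
    have hA0 : 0 < A := by positivity
    have hpt : ∀ y ∈ ball z ρ, u y ≤ l + A * ((1 - ‖y‖) ^ γ * ‖fderiv ℝ f y‖ ^ α) := fun y hy => by
      have h1 : ‖fderiv ℝ f y v‖ ≤ ‖fderiv ℝ f y‖ := by
        simpa [hv] using (fderiv ℝ f y).le_opNorm v
      have h2 : u y ≤ ‖fderiv ℝ f y‖ ^ 2 := by simp only [hu]; gcongr
      have h3 : 1 ≤ ρ ^ (-γ) * (1 - ‖y‖) ^ γ := by
        have h4 : ρ ^ γ ≤ (1 - ‖y‖) ^ γ := Real.rpow_le_rpow hρ0.le (hball y hy) hγ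
        rw [Real.rpow_neg hρ0.le, inv_mul_eq_div, one_le_div (by positivity)]
        exact h4
      have h5 := sq_le_add_rpow_mul_rpow (norm_nonneg (fderiv ℝ f y)) hl0 hα
      have h6 : l ^ (1 - α / 2) * ‖fderiv ℝ f y‖ ^ α * 1
          ≤ l ^ (1 - α / 2) * ‖fderiv ℝ f y‖ ^ α * (ρ ^ (-γ) * (1 - ‖y‖) ^ γ) := by gcongr
      calc u y ≤ l + l ^ (1 - α / 2) * ‖fderiv ℝ f y‖ ^ α * 1 := by linarith
        _ ≤ l + l ^ (1 - α / 2) * ‖fderiv ℝ f y‖ ^ α * (ρ ^ (-γ) * (1 - ‖y‖) ^ γ) := by linarith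
        _ = _ := by rw [hA]; ring
    have hintl : Integrable (fun _ => l) (μ.restrict (ball z ρ)) :=
      integrableOn_const measure_ball_lt_top.ne
    have hintA := (hK.mono_set hsubset).const_mul A
    have hint : IntegrableOn (fun y => l + A * ((1 - ‖y‖) ^ γ * ‖fderiv ℝ f y‖ ^ α))
        (ball z ρ) μ := hintl.add hintA
    have hup : ∫⁻ y in ball z ρ, ENNReal.ofReal (u y) ∂μ
        ≤ ENNReal.ofReal (l * μ.real (ball z ρ) + A * K) := by
      refine (setLIntegral_mono' measurableSet_ball fun y hy =>
        ENNReal.ofReal_le_ofReal (hpt y hy)).trans ?_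
      rw [← ofReal_integral_eq_lintegral_ofReal hint]
      · refine ENNReal.ofReal_le_ofReal ?_
        rw [integral_add hintl hintA, integral_const_mul, setIntegral_const, smul_eq_mul,
          mul_comm l]
        have := setIntegral_mono_set hK ((ae_restrict_mem measurableSet_ball).mono hnn)
          hsubset.eventuallyLE
        gcongr
      · refine (ae_restrict_mem measurableSet_ball).mono fun y hy => ?_
        have := hnn y (hsubset hy)
        dsimp only [Pi.zero_apply]
        positivity
    have hmb : μ.real (ball z ρ) = ρ ^ m * ω := by
      rw [hω, measureReal_def, Measure.addHaar_ball μ z hρ0.le, ENNReal.toReal_mul,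
        ENNReal.toReal_ofReal (by positivity)]
      rfl
    have hreal : u z * (ρ ^ m * ω) ≤ l * (ρ ^ m * ω) + A * K := by
      have h1 := hmean.trans hup
      rw [← ENNReal.ofReal_toReal (measure_ball_lt_top (μ := μ) (x := z) (r := ρ)).ne,
        ← measureReal_def, ← ENNReal.ofReal_mul (by positivity), hmb] at h1
      exact (ENNReal.ofReal_le_ofReal_iff (by positivity)).1 h1
    have hAl : A = l * ρ ^ m := by
      rw [hA, hl, ← Real.rpow_mul hρ0.le, ← Real.rpow_natCast ρ m, ← Real.rpow_add hρ0,
        ← Real.rpow_add hρ0]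
      congr 1
      linear_combination hqα
    have huz : u z ≤ l * (1 + K / ω) := by
      have hpos : 0 < ρ ^ m * ω := by positivity
      refine le_of_mul_le_mul_right (hreal.trans_eq ?_) hpos
      rw [hAl]
      field_simp
    have hl2 : l = (ρ ^ (-(q + 1))) ^ 2 := by
      rw [hl, ← Real.rpow_natCast, ← Real.rpow_mul hρ0.le]
      congr 1
      push_cast
      ring
    rw [hl2] at huz
    have h7 : ‖fderiv ℝ f z v‖ ^ 2 ≤ (√(1 + K / ω) * ρ ^ (-(q + 1))) ^ 2 := by
      rw [mul_pow, Real.sq_sqrt (by positivity)]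
      linarith
    exact le_of_sq_le_sq h7 (by positivity)
  refine hbound.trans_eq ?_
  rw [hρ, Real.div_rpow (by linarith) (by norm_num), Real.rpow_neg (by norm_num : (0 : ℝ) ≤ 2)]
  field_simp

omit [FiniteDimensional ℝ E] [MeasurableSpace E] [BorelSpace E] [Nontrivial E] in
theorem exists_norm_le_of_norm_fderiv_le (hq : 0 < q) (hf : ContDiffOn ℝ 1 f (ball 0 1)) {C : ℝ}
    (hC : 0 ≤ C) (hD : ∀ z ∈ ball (0 : E) 1, ‖fderiv ℝ f z‖ ≤ C * (1 - ‖z‖) ^ (-(q + 1))) :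
    ∃ B, 0 ≤ B ∧ ∀ z ∈ ball (0 : E) 1, ‖f z‖ ≤ B * (1 - ‖z‖) ^ (-q) := by
  refine ⟨‖f 0‖ + C / q, by positivity, fun z hz => ?_⟩
  have hz1 : ‖z‖ < 1 := by simpa using hz
  have hpos : ∀ t ∈ Icc (0 : ℝ) 1, 0 < 1 - t * ‖z‖ := fun t ht => by
    nlinarith [ht.1, ht.2, norm_nonneg z]
  have hmem : ∀ t ∈ Icc (0 : ℝ) 1, t • z ∈ ball (0 : E) 1 := fun t ht => by
    have := hpos t ht
    simp only [mem_ball, dist_zero_right, norm_smul, Real.norm_eq_abs, abs_of_nonneg ht.1]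
    linarith
  have hg : ∀ t ∈ Icc (0 : ℝ) 1, HasDerivAt (fun t : ℝ => f (t • z)) (fderiv ℝ f (t • z) z) t := by
    intro t ht
    have h1 : DifferentiableAt ℝ f (t • z) :=
      (hf.differentiableOn (by norm_num)).differentiableAt (isOpen_ball.mem_nhds (hmem t ht))
    have h2 : HasDerivAt (fun t : ℝ => t • z) z t := by
      simpa using (hasDerivAt_id t).smul_const z
    exact h1.hasFDerivAt.comp_hasDerivAt t h2
  -- The comparison function is the primitive along the ray of the bound on the derivative, which is
  -- where the denominator `q` comes from.
  have hB : ∀ t ∈ Icc (0 : ℝ) 1,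
      HasDerivAt (fun t : ℝ => ‖f 0‖ + C / q * (1 - t * ‖z‖) ^ (-q))
        (C * (1 - t * ‖z‖) ^ (-(q + 1)) * ‖z‖) t := by
    intro t ht
    have h1 : HasDerivAt (fun t : ℝ => 1 - t * ‖z‖) (-‖z‖) t := by
      simpa using ((hasDerivAt_id t).mul_const ‖z‖).const_sub 1
    have h2 := ((h1.rpow_const (p := -q) (Or.inl (hpos t ht).ne')).const_mul (C / q)).const_add ‖f 0‖
    refine h2.congr_deriv ?_
    rw [show -q - 1 = -(q + 1) by ring]
    field_simp
  have key := image_norm_le_of_norm_deriv_right_le_deriv_boundary' (a := 0) (b := 1)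
    (f := fun t : ℝ => f (t • z)) (f' := fun t => fderiv ℝ f (t • z) z)
    (B := fun t : ℝ => ‖f 0‖ + C / q * (1 - t * ‖z‖) ^ (-q))
    (B' := fun t => C * (1 - t * ‖z‖) ^ (-(q + 1)) * ‖z‖)
    (fun t ht => (hg t ht).continuousAt.continuousWithinAt)
    (fun t ht => (hg t (Ico_subset_Icc_self ht)).hasDerivWithinAt)
    (by simp; positivity)
    (fun t ht => (hB t ht).continuousAt.continuousWithinAt)
    (fun t ht => (hB t (Ico_subset_Icc_self ht)).hasDerivWithinAt)
    (fun t ht => by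
      have ht' := Ico_subset_Icc_self ht
      refine ((fderiv ℝ f (t • z)).le_opNorm z).trans ?_
      have := hD _ (hmem t ht')
      rw [norm_smul, Real.norm_eq_abs, abs_of_nonneg ht.1] at this
      gcongr) (right_mem_Icc.2 zero_le_one)
  simp only [one_smul, one_mul] at key
  refine key.trans ?_
  have h1 : 1 ≤ (1 - ‖z‖) ^ (-q) :=
    Real.one_le_rpow_of_pos_of_le_one_of_nonpos (by linarith) (by linarith [norm_nonneg z])
      (by linarith)
  rw [add_mul]
  gcongr
  exact le_mul_of_one_le_right (norm_nonneg _) h1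

omit [FiniteDimensional ℝ E] [InnerProductSpace ℝ E] [MeasurableSpace E] [BorelSpace E]
  [Nontrivial E] in
theorem exists_regPow_le (hq : 0 ≤ q) {B : ℝ}
    (hB : ∀ z ∈ ball (0 : E) 1, ‖f z‖ ≤ B * (1 - ‖z‖) ^ (-q)) {s : ℝ} (hs : 0 ≤ s) :
    ∃ C, 0 ≤ C ∧ ∀ z ∈ ball (0 : E) 1, regPow s f z ≤ C * (1 - ‖z‖) ^ (-(s * q)) := by
  refine ⟨(1 + B ^ 2) ^ (s / 2), by positivity, fun z hz => ?_⟩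
  have hz1 : ‖z‖ < 1 := by simpa using hz
  have hd : 0 < 1 - ‖z‖ := by linarith
  have h1 : 1 ≤ (1 - ‖z‖) ^ (-q) :=
    Real.one_le_rpow_of_pos_of_le_one_of_nonpos hd (by linarith [norm_nonneg z]) (by linarith)
  have h2 : ‖f z‖ ^ 2 ≤ (B * (1 - ‖z‖) ^ (-q)) ^ 2 := by
    have := hB z hz
    gcongr
  have h3 : 1 + ‖f z‖ ^ 2 ≤ (1 + B ^ 2) * ((1 - ‖z‖) ^ (-q)) ^ 2 := by
    have : 1 ≤ ((1 - ‖z‖) ^ (-q)) ^ 2 := one_le_pow₀ h1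
    rw [mul_pow] at h2
    linarith
  have h4 : (((1 - ‖z‖) ^ (-q)) ^ 2) ^ (s / 2) = (1 - ‖z‖) ^ (-(s * q)) := by
    rw [← Real.rpow_natCast, ← Real.rpow_mul hd.le, ← Real.rpow_mul hd.le]
    congr 1
    push_cast
    ring
  calc regPow s f z ≤ ((1 + B ^ 2) * ((1 - ‖z‖) ^ (-q)) ^ 2) ^ (s / 2) :=
        Real.rpow_le_rpow (by positivity) h3 (by linarith)
    _ = _ := by rw [Real.mul_rpow (by positivity) (by positivity), h4]

omit [MeasurableSpace E] [BorelSpace E] [FiniteDimensional ℝ E] [Nontrivial E] in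
-- The growth of the power of `f` uses up `(p - 2) * q` of the weight and leaves `((1 - ‖z‖)^q
-- ‖Df‖)²`. The elementary inequality with level 1 raises this to the power `α`, and `γ ≤ q * α`
-- with `1 - ‖z‖ ≤ 1` recovers the Dirichlet weight.
theorem weighted_energy_le {p : ℝ} (hα : 2 ≤ α) (hγα : γ ≤ q * α) {C : ℝ} (hC0 : 0 ≤ C)
    (hC : ∀ z ∈ ball (0 : E) 1, regPow (p - 2) f z ≤ C * (1 - ‖z‖) ^ (-((p - 2) * q)))
    {z : E} (hz : z ∈ ball (0 : E) 1) :
    (1 - ‖z‖) ^ (p * q) * (regPow (p - 2) f z * ‖fderiv ℝ f z‖ ^ 2)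
      ≤ C * (1 + (1 - ‖z‖) ^ γ * ‖fderiv ℝ f z‖ ^ α) := by
  have hz1 : ‖z‖ < 1 := by simpa using hz
  have hd : 0 < 1 - ‖z‖ := by linarith
  have h1 : (1 - ‖z‖) ^ (p * q) * (1 - ‖z‖) ^ (-((p - 2) * q)) = ((1 - ‖z‖) ^ q) ^ 2 := by
    rw [← Real.rpow_add hd, ← Real.rpow_natCast, ← Real.rpow_mul hd.le]
    congr 1
    push_cast
    ring
  have h2 := sq_le_add_rpow_mul_rpow
    (show 0 ≤ (1 - ‖z‖) ^ q * ‖fderiv ℝ f z‖ by positivity) one_pos hα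
  rw [Real.one_rpow, one_mul, Real.mul_rpow (by positivity) (by positivity),
    ← Real.rpow_mul hd.le] at h2
  have h3 : (1 - ‖z‖) ^ (q * α) ≤ (1 - ‖z‖) ^ γ :=
    Real.rpow_le_rpow_of_exponent_ge hd (by linarith [norm_nonneg z]) hγα
  calc (1 - ‖z‖) ^ (p * q) * (regPow (p - 2) f z * ‖fderiv ℝ f z‖ ^ 2)
      ≤ (1 - ‖z‖) ^ (p * q) * (C * (1 - ‖z‖) ^ (-((p - 2) * q)) * ‖fderiv ℝ f z‖ ^ 2) := by
        have := hC z hz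
        gcongr
    _ = C * (((1 - ‖z‖) ^ (p * q) * (1 - ‖z‖) ^ (-((p - 2) * q))) * ‖fderiv ℝ f z‖ ^ 2) := by ring
    _ = C * ((1 - ‖z‖) ^ q * ‖fderiv ℝ f z‖) ^ 2 := by rw [h1, mul_pow]
    _ ≤ C * (1 + (1 - ‖z‖) ^ (q * α) * ‖fderiv ℝ f z‖ ^ α) := by gcongr
    _ ≤ _ := by gcongr

omit [MeasurableSpace E] [BorelSpace E] [Nontrivial E] in
theorem continuousOn_laplacian {u : E → ℝ} {R : ℝ} (hu : ContDiffOn ℝ 2 u (ball 0 R)) :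
    ContinuousOn (Δ u) (ball 0 R) := by
  have hd : ContDiffOn ℝ 1 (fderiv ℝ u) (ball 0 R) :=
    hu.fderiv_of_isOpen isOpen_ball (by norm_num)
  refine ContinuousOn.congr (continuousOn_finsetSum _ fun i _ => ?_)
    fun z hz => laplacian_eq_sum_fderiv (hu.contDiffAt (isOpen_ball.mem_nhds hz))
  exact ((hd.clm_apply contDiffOn_const).fderiv_of_isOpen (m := 0) isOpen_ball
    (by norm_num)).continuousOn.clm_apply continuousOn_const

theorem exists_sphereIntegral_regPow_le (hτ : 0 ≤ τ) (hη : 0 ≤ η) (hα : 2 ≤ α) (hγ : 0 ≤ γ)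
    (hq : q = (Module.finrank ℝ E + γ) / α - 1) (hq0 : 0 < q) (hγα : γ ≤ q * α)
    (hf : ContDiffOn ℝ 3 f (ball 0 1))
    (hY : ∀ z ∈ ball (0 : E) 1, Δ f z = (τ : ℂ) * f z + (η : ℂ) * ((f z).re : ℂ))
    (hK : IntegrableOn (fun z => (1 - ‖z‖) ^ γ * ‖fderiv ℝ f z‖ ^ α) (ball 0 1) μ)
    {p : ℝ} (hp : 2 ≤ p) (hpq : p * q = 1) :
    ∃ B, ∀ r ∈ Ioo (0 : ℝ) 1, sphereIntegral μ (regPow p f) r ≤ B := by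
  obtain ⟨C₁, hC₁, h₁⟩ := exists_norm_fderiv_le μ hτ hη hα hγ hq hf hY hK
  obtain ⟨C₂, hC₂, h₂⟩ := exists_norm_le_of_norm_fderiv_le hq0 (hf.of_le (by norm_num)) hC₁ h₁
  obtain ⟨C₃, hC₃, h₃⟩ := exists_regPow_le hq0.le h₂ (show 0 ≤ p by linarith)
  obtain ⟨C₄, hC₄, h₄⟩ := exists_regPow_le hq0.le h₂ (show 0 ≤ p - 2 by linarith)
  have hat : ∀ z ∈ ball (0 : E) 1, ContDiffAt ℝ 2 f z := fun z hz =>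
    (hf.contDiffAt (isOpen_ball.mem_nhds hz)).of_le (by norm_num)
  have hU : ContDiffOn ℝ 2 (regPow p f) (ball 0 1) := fun z hz =>
    (contDiffAt_regPow p (hat z hz)).contDiffWithinAt
  have hb := fun z hz => laplacian_regPow_bounds hτ hη hp (hat z hz) (hY z hz)
  set A := p * (p - 1) * Module.finrank ℝ E with hA
  have hA0 : 0 ≤ A := by
    have : 0 ≤ p - 1 := by linarith
    positivity
  have hint : IntegrableOn (fun z => (1 - ‖z‖) * Δ (regPow p f) z) (ball 0 1) μ := by
    refine Integrable.mono' (g := fun z => A * (C₄ * (1 + (1 - ‖z‖) ^ γ * ‖fderiv ℝ f z‖ ^ α))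
      + p * (τ + η) * C₃) ?_ ?_ ?_
    · exact ((((integrableOn_const measure_ball_lt_top.ne).add hK).const_mul C₄).const_mul A).add
        (integrableOn_const measure_ball_lt_top.ne)
    · exact (ContinuousOn.mul (by fun_prop) (continuousOn_laplacian hU)).aestronglyMeasurable
        measurableSet_ball
    · refine (ae_restrict_mem measurableSet_ball).mono fun z hz => ?_
      have hz1 : ‖z‖ < 1 := by simpa using hz
      have hd : 0 < 1 - ‖z‖ := by linarith
      rw [Real.norm_of_nonneg (mul_nonneg hd.le (hb z hz).1)]
      have h5 := weighted_energy_le hα hγα hC₄ h₄ hz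
      have h6 := h₃ z hz
      -- The choice `p * q = 1` makes the energy weight exactly `1 - ‖z‖` and makes `(1 - ‖z‖) *
      -- regPow p f z` bounded.
      rw [hpq, Real.rpow_one] at h5
      rw [hpq, Real.rpow_neg_one, ← div_eq_mul_inv, le_div_iff₀ hd] at h6
      calc (1 - ‖z‖) * Δ (regPow p f) z
          ≤ (1 - ‖z‖) * (A * (regPow (p - 2) f z * ‖fderiv ℝ f z‖ ^ 2)
            + p * (τ + η) * regPow p f z) := mul_le_mul_of_nonneg_left (hb z hz).2 hd.le
        _ = A * ((1 - ‖z‖) * (regPow (p - 2) f z * ‖fderiv ℝ f z‖ ^ 2))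
            + p * (τ + η) * (regPow p f z * (1 - ‖z‖)) := by ring
        _ ≤ _ := by gcongr
  have hsub : ∀ z ∈ ball (0 : E) 1, 0 ≤ Δ (regPow p f) z := fun z hz => (hb z hz).1
  have hnn : 0 ≤ ∫ z in ball (0 : E) 1, (1 - ‖z‖) * Δ (regPow p f) z ∂μ :=
    setIntegral_nonneg measurableSet_ball fun z hz => by
      have hz1 : ‖z‖ < 1 := by simpa using hz
      exact mul_nonneg (by linarith) (hsub z hz)
  refine ⟨sphereIntegral μ (regPow p f) (1 / 2)
    + ((1 / 2 : ℝ) ^ (Module.finrank ℝ E - 1) * (1 / 2))⁻¹ *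
      ∫ z in ball (0 : E) 1, (1 - ‖z‖) * Δ (regPow p f) z ∂μ, fun r hr => ?_⟩
  -- The estimate from radius `a = 1 / 2` covers the outer radii; the inner ones follow by
  -- monotonicity of the means.
  rcases le_or_gt (1 / 2) r with h | h
  · exact sphereIntegral_le_of_subharmonic μ hU hsub hint (by norm_num) h hr.2
  · have h7 := sphereIntegral_monotoneOn μ hU hsub ⟨hr.1.le, hr.2⟩
      (⟨by norm_num, by norm_num⟩ : (1 / 2 : ℝ) ∈ Ico 0 1) h.le
    have : 0 ≤ ((1 / 2 : ℝ) ^ (Module.finrank ℝ E - 1) * (1 / 2))⁻¹ *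
      ∫ z in ball (0 : E) 1, (1 - ‖z‖) * Δ (regPow p f) z ∂μ := by positivity
    linarith

end Growth

/-! ### A one-dimensional weighted Hardy inequality. -/

/-- Integrate the derivative of `-(1 - t)^{s-1} U`: the boundary term at `R` has a favourable sign
and is dropped. The cross term `(1 - t)^{s-1} U'` is split by the arithmetic–geometric mean
inequality so that half of the `U` integral is absorbed on the left. -/
theorem intervalIntegral_hardy_le {s a R c : ℝ} (hs : 1 < s) (hc : 0 ≤ c) (haR : a ≤ R)
    (hR : R < 1) {U U' W : ℝ → ℝ} (hU : ∀ t ∈ Icc a R, HasDerivAt U (U' t) t)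
    (hU' : ContinuousOn U' (Icc a R)) (hW : ContinuousOn W (Icc a R))
    (hU0 : ∀ t ∈ Icc a R, 0 ≤ U t) (hW0 : ∀ t ∈ Icc a R, 0 ≤ W t)
    (hUW : ∀ t ∈ Icc a R, U' t ^ 2 ≤ c * U t * W t) :
    (s - 1) / 2 * ∫ t in a..R, (1 - t) ^ (s - 2) * U t
      ≤ (1 - a) ^ (s - 1) * U a + c / (2 * (s - 1)) * ∫ t in a..R, (1 - t) ^ s * W t := by
  have hpos : ∀ t ∈ Icc a R, 0 < 1 - t := fun t ht => by linarith [ht.2]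
  have hUc : ContinuousOn U (Icc a R) := fun t ht => (hU t ht).continuousAt.continuousWithinAt
  have hpow : ∀ r : ℝ, ContinuousOn (fun t : ℝ => (1 - t) ^ r) (Icc a R) := fun r =>
    ContinuousOn.rpow_const (by fun_prop) fun t ht => Or.inl (hpos t ht).ne'
  have hii : ∀ {g : ℝ → ℝ}, ContinuousOn g (Icc a R) → IntervalIntegrable g volume a R :=
    fun hg => ContinuousOn.intervalIntegrable (by rwa [uIcc_of_le haR])
  have hx := (hpow (s - 2)).mul hUc
  have hy := (hpow s).mul hW
  set G : ℝ → ℝ := fun t => -((1 - t) ^ (s - 1) * U t) with hG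
  set G' : ℝ → ℝ := fun t => (s - 1) * ((1 - t) ^ (s - 2) * U t) - (1 - t) ^ (s - 1) * U' t with hG'
  have hder : ∀ t ∈ Icc a R, HasDerivAt G (G' t) t := by
    intro t ht
    have h1 : HasDerivAt (fun t : ℝ => 1 - t) (-1) t := by
      simpa using (hasDerivAt_id t).const_sub 1
    refine ((h1.rpow_const (p := s - 1) (Or.inl (hpos t ht).ne')).fun_mul (hU t ht)).neg.congr_deriv ?_
    rw [hG', show s - 1 - 1 = s - 2 by ring]
    ring
  have hG'c : ContinuousOn G' (Icc a R) := (continuousOn_const.mul hx).sub ((hpow _).mul hU')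
  have hftc : ∫ t in a..R, G' t = G R - G a :=
    intervalIntegral.integral_eq_sub_of_hasDerivAt (by rwa [uIcc_of_le haR]) (hii hG'c)
  have hGR : G R ≤ 0 := by
    have := hU0 R ⟨haR, le_rfl⟩
    have := hpos R ⟨haR, le_rfl⟩
    simp only [hG]
    rw [neg_nonpos]
    positivity
  have hmono : ∫ t in a..R, ((s - 1) / 2 * ((1 - t) ^ (s - 2) * U t)
      - c / (2 * (s - 1)) * ((1 - t) ^ s * W t)) ≤ ∫ t in a..R, G' t := by
    refine intervalIntegral.integral_mono_on haR
      (hii ((continuousOn_const.mul hx).sub (continuousOn_const.mul hy))) (hii hG'c) fun t ht => ?_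
    have hd := hpos t ht
    have hs1 : 0 < s - 1 := by linarith
    set x := (1 - t) ^ (s - 2) * U t with hxdef
    set y := (1 - t) ^ s * W t with hydef
    have hx0 : 0 ≤ x := mul_nonneg (by positivity) (hU0 t ht)
    have hy0 : 0 ≤ y := mul_nonneg (by positivity) (hW0 t ht)
    have h1 : ((1 - t) ^ (s - 1) * U' t) ^ 2 ≤ c * x * y := by
      have h2 : ((1 - t) ^ (s - 1)) ^ 2 = (1 - t) ^ (s - 2) * (1 - t) ^ s := by
        rw [← Real.rpow_natCast, ← Real.rpow_mul hd.le, ← Real.rpow_add hd]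
        congr 1
        push_cast
        ring
      rw [mul_pow, h2]
      calc (1 - t) ^ (s - 2) * (1 - t) ^ s * U' t ^ 2
          ≤ (1 - t) ^ (s - 2) * (1 - t) ^ s * (c * U t * W t) := by
            have := hUW t ht
            gcongr
        _ = c * x * y := by rw [hxdef, hydef]; ring
    have h3 : (1 - t) ^ (s - 1) * U' t ≤ (s - 1) / 2 * x + c / (2 * (s - 1)) * y := by
      refine le_of_sq_le_sq (h1.trans ?_) (by positivity)
      have h4 : c * x * y = 4 * ((s - 1) / 2 * x) * (c / (2 * (s - 1)) * y) := by
        field_simp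
        ring
      rw [h4]
      nlinarith [sq_nonneg ((s - 1) / 2 * x - c / (2 * (s - 1)) * y)]
    simp only [hG']
    linarith
  have hxi : IntervalIntegrable (fun t => (s - 1) / 2 * ((1 - t) ^ (s - 2) * U t)) volume a R :=
    hii (continuousOn_const.mul hx)
  have hyi : IntervalIntegrable (fun t => c / (2 * (s - 1)) * ((1 - t) ^ s * W t)) volume a R :=
    hii (continuousOn_const.mul hy)
  rw [intervalIntegral.integral_sub hxi hyi, intervalIntegral.integral_const_mul,
    intervalIntegral.integral_const_mul, hftc] at hmono
  simp only [hG] at hmono hGR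
  linarith

theorem setLIntegral_Icc_eq_ofReal {a R : ℝ} (haR : a ≤ R) {g : ℝ → ℝ}
    (hg : ContinuousOn g (Icc a R)) (hg0 : ∀ t ∈ Icc a R, 0 ≤ g t) :
    ∫⁻ t in Icc a R, ENNReal.ofReal (g t) = ENNReal.ofReal (∫ t in a..R, g t) := by
  rw [intervalIntegral.integral_of_le haR, ← integral_Icc_eq_integral_Ioc,
    ofReal_integral_eq_lintegral_ofReal (hg.integrableOn_compact isCompact_Icc)
      ((ae_restrict_mem measurableSet_Icc).mono hg0)]

/-- The constants above do not depend on `R`, so exhausting `[a, 1)` by compact intervals needs no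
prior finiteness; absorption takes place only on those intervals, where every integral is finite. -/
theorem lintegral_hardy_le {s a c : ℝ} (hs : 1 < s) (hc : 0 ≤ c) (ha : a < 1)
    {U U' W : ℝ → ℝ} (hU : ∀ t ∈ Ico a 1, HasDerivAt U (U' t) t)
    (hU' : ContinuousOn U' (Ico a 1)) (hW : ContinuousOn W (Ico a 1))
    (hU0 : ∀ t ∈ Ico a 1, 0 ≤ U t) (hW0 : ∀ t ∈ Ico a 1, 0 ≤ W t)
    (hUW : ∀ t ∈ Ico a 1, U' t ^ 2 ≤ c * U t * W t) :
    ∫⁻ t in Ico a 1, ENNReal.ofReal ((1 - t) ^ (s - 2) * U t)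
      ≤ ENNReal.ofReal (2 / (s - 1) * ((1 - a) ^ (s - 1) * U a))
        + ENNReal.ofReal (c / (s - 1) ^ 2)
          * ∫⁻ t in Ico a 1, ENNReal.ofReal ((1 - t) ^ s * W t) := by
  have hs1 : 0 < s - 1 := by linarith
  obtain ⟨R, hRmono, hR1, hRlim⟩ := exists_seq_strictMono_tendsto' (show a < (1 : ℝ) from ha)
  have hun : Ico a 1 = ⋃ k, Icc a (R k) := by
    ext t
    simp only [mem_iUnion]
    constructor
    · intro ht
      obtain ⟨k, hk⟩ := (hRlim.eventually_const_lt ht.2).exists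
      exact ⟨k, ht.1, hk.le⟩
    · rintro ⟨k, hk⟩
      exact ⟨hk.1, hk.2.trans_lt (hR1 k).2⟩
  have hdir : Directed (· ⊆ ·) fun k => Icc a (R k) :=
    directed_of_isDirected_le fun i j hij => Icc_subset_Icc_right (hRmono.monotone hij)
  conv_lhs => rw [hun]
  rw [setLIntegral_iUnion_of_directed _ hdir]
  refine iSup_le fun k => ?_
  have hsub : Icc a (R k) ⊆ Ico a 1 := fun t ht => ⟨ht.1, ht.2.trans_lt (hR1 k).2⟩
  have hak : a ≤ R k := (hR1 k).1.le
  have hpos : ∀ t ∈ Icc a (R k), 0 < 1 - t := fun t ht => by linarith [(hsub ht).2]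
  have hpow : ∀ r : ℝ, ContinuousOn (fun t : ℝ => (1 - t) ^ r) (Icc a (R k)) := fun r =>
    ContinuousOn.rpow_const (by fun_prop) fun t ht => Or.inl (hpos t ht).ne'
  have hUc : ContinuousOn U (Icc a (R k)) := fun t ht =>
    (hU t (hsub ht)).continuousAt.continuousWithinAt
  have hmain := intervalIntegral_hardy_le hs hc hak (hR1 k).2 (fun t ht => hU t (hsub ht))
    (hU'.mono hsub) (hW.mono hsub) (fun t ht => hU0 t (hsub ht)) (fun t ht => hW0 t (hsub ht))
    fun t ht => hUW t (hsub ht)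
  have hWnn : 0 ≤ ∫ t in a..R k, (1 - t) ^ s * W t :=
    intervalIntegral.integral_nonneg hak fun t ht =>
      mul_nonneg (Real.rpow_nonneg (hpos t ht).le _) (hW0 t (hsub ht))
  have hUa : 0 ≤ (1 - a) ^ (s - 1) * U a :=
    mul_nonneg (Real.rpow_nonneg (by linarith) _) (hU0 a ⟨le_rfl, ha⟩)
  rw [setLIntegral_Icc_eq_ofReal (g := fun t => (1 - t) ^ (s - 2) * U t) hak
    ((hpow _).mul hUc) fun t ht =>
    mul_nonneg (Real.rpow_nonneg (hpos t ht).le _) (hU0 t (hsub ht))]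
  have h1 : ∫ t in a..R k, (1 - t) ^ (s - 2) * U t ≤ 2 / (s - 1) * ((1 - a) ^ (s - 1) * U a)
      + c / (s - 1) ^ 2 * ∫ t in a..R k, (1 - t) ^ s * W t := by
    have h2 := mul_le_mul_of_nonneg_left hmain (show 0 ≤ 2 / (s - 1) by positivity)
    calc _ = 2 / (s - 1) * ((s - 1) / 2 * ∫ t in a..R k, (1 - t) ^ (s - 2) * U t) := by
          field_simp
      _ ≤ _ := h2
      _ = _ := by field_simp
  refine (ENNReal.ofReal_le_ofReal h1).trans ?_
  rw [ENNReal.ofReal_add (by positivity) (by positivity),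
    ENNReal.ofReal_mul (p := c / (s - 1) ^ 2) (by positivity),
    ← setLIntegral_Icc_eq_ofReal (g := fun t => (1 - t) ^ s * W t) hak
      ((hpow _).mul (hW.mono hsub)) fun t ht =>
      mul_nonneg (Real.rpow_nonneg (hpos t ht).le _) (hW0 t (hsub ht))]
  gcongr

/-! ### The Bergman estimate, ray by ray. -/

section Bergman

variable {E : Type*} [NormedAddCommGroup E] [InnerProductSpace ℝ E] [FiniteDimensional ℝ E]
  [MeasurableSpace E] [BorelSpace E] [Nontrivial E] (μ : Measure E) [μ.IsAddHaarMeasure]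
  {τ η α γ q : ℝ} {f : E → ℂ}

/-- The annulus `1/2 ≤ ‖z‖ < 1`. -/
def outerShell (E : Type*) [NormedAddCommGroup E] : Set E := {z | 1 / 2 ≤ ‖z‖ ∧ ‖z‖ < 1}

omit [InnerProductSpace ℝ E] [FiniteDimensional ℝ E] [Nontrivial E] in
theorem measurableSet_outerShell : MeasurableSet (outerShell E) :=
  (measurableSet_le measurable_const measurable_norm).inter
    (measurableSet_lt measurable_norm measurable_const)

omit [FiniteDimensional ℝ E] [MeasurableSpace E] [BorelSpace E] [Nontrivial E] in
-- Supplies the hypothesis `U'² ≤ c U W` of the Hardy inequality, with `c = p²`.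
theorem hasDerivAt_regPow_ray (p : ℝ) {ζ : E} (hζ : ‖ζ‖ = 1) {t : ℝ}
    (hf : DifferentiableAt ℝ f (t • ζ)) :
    HasDerivAt (fun t : ℝ => regPow p f (t • ζ))
      (p * regPow (p - 2) f (t • ζ) * inner ℝ (f (t • ζ)) (fderiv ℝ f (t • ζ) ζ)) t ∧
    (p * regPow (p - 2) f (t • ζ) * inner ℝ (f (t • ζ)) (fderiv ℝ f (t • ζ) ζ)) ^ 2
      ≤ p ^ 2 * regPow p f (t • ζ) * (regPow (p - 2) f (t • ζ) * ‖fderiv ℝ f (t • ζ)‖ ^ 2) := by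
  have h2 : HasDerivAt (fun t : ℝ => t • ζ) ζ t := by
    simpa using (hasDerivAt_id t).smul_const ζ
  have h3 : HasDerivAt (fun t : ℝ => f (t • ζ)) (fderiv ℝ f (t • ζ) ζ) t :=
    hf.hasFDerivAt.comp_hasDerivAt t h2
  have h4 := h3.norm_sq.const_add 1
  have hpos : 0 < 1 + ‖f (t • ζ)‖ ^ 2 := by positivity
  constructor
  · refine (h4.rpow_const (p := p / 2) (Or.inl hpos.ne')).congr_deriv ?_
    rw [regPow, show (p - 2) / 2 = p / 2 - 1 by ring]
    ring
  · have h5 := abs_real_inner_le_norm (f (t • ζ)) (fderiv ℝ f (t • ζ) ζ)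
    have h6 : ‖fderiv ℝ f (t • ζ) ζ‖ ≤ ‖fderiv ℝ f (t • ζ)‖ := by
      simpa [hζ] using (fderiv ℝ f (t • ζ)).le_opNorm ζ
    have h7 : (inner ℝ (f (t • ζ)) (fderiv ℝ f (t • ζ) ζ)) ^ 2
        ≤ (1 + ‖f (t • ζ)‖ ^ 2) * ‖fderiv ℝ f (t • ζ)‖ ^ 2 := by
      rw [← sq_abs]
      calc _ ≤ (‖f (t • ζ)‖ * ‖fderiv ℝ f (t • ζ)‖) ^ 2 := by gcongr; exact h5.trans (by gcongr)
        _ = ‖f (t • ζ)‖ ^ 2 * ‖fderiv ℝ f (t • ζ)‖ ^ 2 := mul_pow _ _ _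
        _ ≤ _ := by gcongr; linarith
    have h8 : regPow p f (t • ζ) = (1 + ‖f (t • ζ)‖ ^ 2) * regPow (p - 2) f (t • ζ) := by
      rw [regPow, regPow]
      nth_rewrite 2 [← Real.rpow_one (1 + ‖f (t • ζ)‖ ^ 2)]
      rw [← Real.rpow_add hpos]
      ring_nf
    rw [h8]
    calc _ = p ^ 2 * regPow (p - 2) f (t • ζ) ^ 2
          * (inner ℝ (f (t • ζ)) (fderiv ℝ f (t • ζ) ζ)) ^ 2 := by ring
      _ ≤ p ^ 2 * regPow (p - 2) f (t • ζ) ^ 2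
          * ((1 + ‖f (t • ζ)‖ ^ 2) * ‖fderiv ℝ f (t • ζ)‖ ^ 2) := by gcongr
      _ = _ := by ring

omit [InnerProductSpace ℝ E] [FiniteDimensional ℝ E] [MeasurableSpace E] [BorelSpace E]
  [Nontrivial E] in
theorem continuousOn_regPow (p : ℝ) {s : Set E} (hf : ContinuousOn f s) :
    ContinuousOn (regPow p f) s :=
  ContinuousOn.rpow_const (by fun_prop) fun z _ => Or.inl (by positivity)

theorem lintegral_regPow_lt_top (hτ : 0 ≤ τ) (hη : 0 ≤ η) (hα : 2 ≤ α) (hγ : 0 ≤ γ)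
    (hq : q = (Module.finrank ℝ E + γ) / α - 1) (hq0 : 0 < q) (hγα : γ ≤ q * α)
    (hf : ContDiffOn ℝ 3 f (ball 0 1))
    (hY : ∀ z ∈ ball (0 : E) 1, Δ f z = (τ : ℂ) * f z + (η : ℂ) * ((f z).re : ℂ))
    (hK : IntegrableOn (fun z => (1 - ‖z‖) ^ γ * ‖fderiv ℝ f z‖ ^ α) (ball 0 1) μ)
    {p : ℝ} (hp : 2 ≤ p) (hpq : 2 ≤ p * q) :
    ∫⁻ z in ball (0 : E) 1, ENNReal.ofReal ((1 - ‖z‖) ^ (p * q - 2) * regPow p f z) ∂μ < ⊤ := by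
  obtain ⟨C₁, hC₁, h₁⟩ := exists_norm_fderiv_le μ hτ hη hα hγ hq hf hY hK
  obtain ⟨C₂, hC₂, h₂⟩ := exists_norm_le_of_norm_fderiv_le hq0 (hf.of_le (by norm_num)) hC₁ h₁
  obtain ⟨C₃, hC₃, h₃⟩ := exists_regPow_le hq0.le h₂ (show 0 ≤ p by linarith)
  obtain ⟨C₄, hC₄, h₄⟩ := exists_regPow_le hq0.le h₂ (show 0 ≤ p - 2 by linarith)
  set s := p * q with hs
  set m := Module.finrank ℝ E with hm
  have hfc : ContinuousOn f (ball 0 1) := hf.continuousOn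
  have hDc : ContinuousOn (fderiv ℝ f) (ball 0 1) :=
    hf.continuousOn_fderiv_of_isOpen isOpen_ball (by norm_num)
  have hdist : ∀ z ∈ ball (0 : E) 1, 0 < 1 - ‖z‖ := fun z hz => by
    have : ‖z‖ < 1 := by simpa using hz
    linarith
  have hpowc : ∀ r : ℝ, ContinuousOn (fun z : E => (1 - ‖z‖) ^ r) (ball 0 1) := fun r =>
    ContinuousOn.rpow_const (by fun_prop) fun z hz => Or.inl (hdist z hz).ne'
  set W : E → ℝ := fun z => regPow (p - 2) f z * ‖fderiv ℝ f z‖ ^ 2 with hW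
  have hWc : ContinuousOn W (ball 0 1) := (continuousOn_regPow _ hfc).mul (hDc.norm.pow 2)
  have hreg0 : ∀ r z, 0 ≤ regPow r f z := fun r z => by unfold regPow; positivity
  have hW0 : ∀ z, 0 ≤ W z := fun z => mul_nonneg (hreg0 _ _) (by positivity)
  set X : E → ℝ≥0∞ := (outerShell E).indicator
    fun z => ENNReal.ofReal ((1 - ‖z‖) ^ (s - 2) * regPow p f z) with hX
  set Y : E → ℝ≥0∞ := (outerShell E).indicator
    fun z => ENNReal.ofReal ((1 - ‖z‖) ^ s * W z) with hYdef
  have hshell : outerShell E ⊆ ball 0 1 := fun z hz => by simpa using hz.2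
  have hXm : Measurable X := measurable_indicator_of_continuousOn measurableSet_outerShell
    ((ENNReal.continuous_ofReal.comp_continuousOn
      ((hpowc _).mul (continuousOn_regPow _ hfc))).mono hshell)
  have hYm : Measurable Y := measurable_indicator_of_continuousOn measurableSet_outerShell
    ((ENNReal.continuous_ofReal.comp_continuousOn ((hpowc _).mul hWc)).mono hshell)
  have hYfin : ∫⁻ z, Y z ∂μ < ⊤ := by
    rw [hYdef, lintegral_indicator measurableSet_outerShell]
    have h5 : IntegrableOn (fun z => C₄ * (1 + (1 - ‖z‖) ^ γ * ‖fderiv ℝ f z‖ ^ α)) (ball 0 1) μ :=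
      ((integrableOn_const measure_ball_lt_top.ne).add hK).const_mul C₄
    refine lt_of_le_of_lt ?_ h5.lintegral_lt_top
    refine (lintegral_mono_set hshell).trans (setLIntegral_mono' measurableSet_ball fun z hz =>
      ENNReal.ofReal_le_ofReal (weighted_energy_le hα hγα hC₄ h₄ hz))
  have hsh : ∀ (ζ : sphere (0 : E) 1) (t : ℝ), 0 < t → (t • (ζ : E) ∈ outerShell E ↔
      t ∈ Ico (1 / 2 : ℝ) 1) := fun ζ t ht => by
    simp [outerShell, norm_smul, abs_of_pos ht]
  have hnorm : ∀ (ζ : sphere (0 : E) 1) (t : ℝ), 0 < t → ‖t • (ζ : E)‖ = t := fun ζ t ht => by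
    simp [norm_smul, abs_of_pos ht]
  have hIoi : Ico (1 / 2 : ℝ) 1 ⊆ Ioi 0 := fun t ht => lt_of_lt_of_le (by norm_num) ht.1
  -- The Hardy boundary term at `t = 1 / 2`, made independent of the ray by the growth bound.
  set D := 2 / (s - 1) * ((1 - 1 / 2) ^ (s - 1) * (C₃ * (1 / 2) ^ (-s))) with hD
  have hray : ∀ ζ : sphere (0 : E) 1,
      ∫⁻ t in Ioi (0 : ℝ), ENNReal.ofReal (t ^ (m - 1)) * X (t • (ζ : E))
      ≤ ENNReal.ofReal D + ENNReal.ofReal (p ^ 2 / (s - 1) ^ 2) * (ENNReal.ofReal (2 ^ (m - 1))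
        * ∫⁻ t in Ioi (0 : ℝ), ENNReal.ofReal (t ^ (m - 1)) * Y (t • (ζ : E))) := by
    intro ζ
    have hζ : ‖(ζ : E)‖ = 1 := norm_eq_of_mem_sphere ζ
    have hin : ∀ t ∈ Ico (1 / 2 : ℝ) 1, t • (ζ : E) ∈ ball (0 : E) 1 := fun t ht =>
      smul_sphere_mem_ball (hIoi ht).le ht.2 ζ
    have hcomp : ContinuousOn (fun t : ℝ => t • (ζ : E)) (Ico (1 / 2) 1) := by fun_prop
    have hdiff : ∀ t ∈ Ico (1 / 2 : ℝ) 1, DifferentiableAt ℝ f (t • (ζ : E)) := fun t ht =>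
      (hf.differentiableOn (by norm_num)).differentiableAt (isOpen_ball.mem_nhds (hin t ht))
    have hH := lintegral_hardy_le (s := s) (a := 1 / 2) (c := p ^ 2) (by linarith) (by positivity)
      (by norm_num) (U := fun t => regPow p f (t • (ζ : E)))
      (U' := fun t => p * regPow (p - 2) f (t • (ζ : E)) *
        inner ℝ (f (t • (ζ : E))) (fderiv ℝ f (t • (ζ : E)) ζ))
      (W := fun t => W (t • (ζ : E)))
      (fun t ht => (hasDerivAt_regPow_ray p hζ (hdiff t ht)).1)
      ((continuousOn_const.mul ((continuousOn_regPow (p - 2) hfc).comp hcomp hin)).mul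
        ((hfc.comp hcomp hin).inner (𝕜 := ℝ) ((hDc.comp hcomp hin).clm_apply continuousOn_const)))
      (hWc.comp hcomp hin) (fun t _ => hreg0 _ _) (fun t _ => hW0 _)
      (fun t ht => (hasDerivAt_regPow_ray p hζ (hdiff t ht)).2)
    -- The Hardy inequality carries no Jacobian. On the shell `2 ^ (-(m - 1)) ≤ t ^ (m - 1) ≤ 1`, so
    -- the Jacobian is dropped on the `X` side and restored on the `Y` side at the cost of `2 ^ (m -
    -- 1)`.
    have hXle : ∫⁻ t in Ioi (0 : ℝ), ENNReal.ofReal (t ^ (m - 1)) * X (t • (ζ : E))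
        ≤ ∫⁻ t in Ico (1 / 2 : ℝ) 1, ENNReal.ofReal ((1 - t) ^ (s - 2) * regPow p f (t • (ζ : E))) := by
      rw [← inter_eq_self_of_subset_left hIoi, ← setLIntegral_indicator measurableSet_Ico]
      refine setLIntegral_mono' measurableSet_Ioi fun t ht => ?_
      by_cases h : t ∈ Ico (1 / 2 : ℝ) 1
      · rw [hX, indicator_of_mem ((hsh ζ t ht).2 h), indicator_of_mem h, hnorm ζ t ht]
        refine mul_le_of_le_one_left' ?_
        rw [ENNReal.ofReal_le_one]
        exact pow_le_one₀ (le_of_lt ht) h.2.le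
      · rw [hX, indicator_of_notMem (mt (hsh ζ t ht).1 h), mul_zero]
        exact zero_le
    have hYle : ∫⁻ t in Ico (1 / 2 : ℝ) 1, ENNReal.ofReal ((1 - t) ^ s * W (t • (ζ : E)))
        ≤ ENNReal.ofReal (2 ^ (m - 1))
          * ∫⁻ t in Ioi (0 : ℝ), ENNReal.ofReal (t ^ (m - 1)) * Y (t • (ζ : E)) := by
      rw [← lintegral_const_mul' _ _ ENNReal.ofReal_ne_top]
      refine (setLIntegral_mono' measurableSet_Ico fun t ht => ?_).trans (lintegral_mono_set hIoi)
      have ht0 : 0 < t := hIoi ht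
      rw [hYdef, indicator_of_mem ((hsh ζ t ht0).2 ht), hnorm ζ t ht0,
        ← mul_assoc (ENNReal.ofReal (2 ^ (m - 1))),
        ← ENNReal.ofReal_mul (p := 2 ^ (m - 1)) (q := t ^ (m - 1)) (by positivity), ← mul_pow]
      refine le_mul_of_one_le_left' ?_
      rw [ENNReal.one_le_ofReal]
      exact one_le_pow₀ (by linarith [ht.1])
    have hbd : regPow p f ((1 / 2 : ℝ) • (ζ : E)) ≤ C₃ * (1 / 2) ^ (-s) := by
      have h := h₃ _ (hin (1 / 2) ⟨le_rfl, by norm_num⟩)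
      rw [hnorm ζ _ (by norm_num)] at h
      norm_num at h ⊢
      exact h
    refine hXle.trans (hH.trans (add_le_add (ENNReal.ofReal_le_ofReal ?_) ?_))
    · have : 0 < s - 1 := by linarith
      rw [hD]
      gcongr
    · gcongr
  have hXfin : ∫⁻ z, X z ∂μ < ⊤ := by
    rw [lintegral_polar_ray μ X hXm]
    refine lt_of_le_of_lt (lintegral_mono hray) ?_
    rw [lintegral_add_left measurable_const, lintegral_const,
      lintegral_const_mul' _ _ ENNReal.ofReal_ne_top,
      lintegral_const_mul' _ _ ENNReal.ofReal_ne_top, ← lintegral_polar_ray μ Y hYm]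
    exact ENNReal.add_lt_top.2 ⟨ENNReal.mul_lt_top ENNReal.ofReal_lt_top (measure_lt_top _ _),
      ENNReal.mul_lt_top ENNReal.ofReal_lt_top
        (ENNReal.mul_lt_top ENNReal.ofReal_lt_top hYfin)⟩
  have hcover : ball (0 : E) 1 ⊆ ball 0 (1 / 2) ∪ outerShell E := fun z hz => by
    have : ‖z‖ < 1 := by simpa using hz
    by_cases h : ‖z‖ < 1 / 2
    · exact Or.inl (by simpa using h)
    · exact Or.inr ⟨not_lt.1 h, this⟩
  -- On the inner half ball the integrand is bounded: the weight is at most 1 because `s ≥ 2`, and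
  -- the growth bound handles the rest.
  refine lt_of_le_of_lt ((lintegral_mono_set hcover).trans (lintegral_union_le _ _ _))
    (ENNReal.add_lt_top.2 ⟨?_, ?_⟩)
  · refine lt_of_le_of_lt (setLIntegral_mono' (g := fun _ => ENNReal.ofReal (C₃ * (1 / 2) ^ (-s)))
      measurableSet_ball fun z hz => ENNReal.ofReal_le_ofReal ?_) ?_
    · have hz2 : ‖z‖ < 1 / 2 := by simpa using hz
      have hd : (1 / 2 : ℝ) ≤ 1 - ‖z‖ := by linarith
      have hz1 : z ∈ ball (0 : E) 1 := by simp; linarith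
      have h6 : (1 - ‖z‖) ^ (s - 2) ≤ 1 :=
        Real.rpow_le_one (by linarith) (by linarith [norm_nonneg z]) (by linarith)
      have h7 : (1 - ‖z‖) ^ (-s) ≤ (1 / 2) ^ (-s) :=
        Real.rpow_le_rpow_of_nonpos (by norm_num) hd (by linarith)
      calc (1 - ‖z‖) ^ (s - 2) * regPow p f z ≤ 1 * regPow p f z :=
            mul_le_mul_of_nonneg_right h6 (hreg0 _ _)
        _ ≤ C₃ * (1 - ‖z‖) ^ (-s) := by rw [one_mul]; exact h₃ z hz1
        _ ≤ _ := by gcongr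
    · rw [setLIntegral_const]
      exact ENNReal.mul_lt_top ENNReal.ofReal_lt_top measure_ball_lt_top
  · rw [← lintegral_indicator measurableSet_outerShell]
    exact hXfin

end Bergman

/-! ### Translation to `ℂⁿ`: boundary distance, Wirtinger derivatives, function spaces. -/

section ComplexBall

variable {n : ℕ}

theorem finrank_real_Cn (n : ℕ) : Module.finrank ℝ (Cn n) = 2 * n := by
  have h := finrank_real_of_complex (Cn n)
  rw [finrank_euclideanSpace_fin] at h
  exact h

theorem bdryDist_eq [Nontrivial (Cn n)] {z : Cn n} (hz : z ∈ unitBall n) :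
    bdryDist z = 1 - ‖z‖ := by
  have hz1 : ‖z‖ < 1 := by simpa [unitBall] using hz
  have hne : (sphere (0 : Cn n) 1).Nonempty := NormedSpace.sphere_nonempty.2 zero_le_one
  rw [bdryDist, unitBall, frontier_ball _ one_ne_zero]
  refine le_antisymm ?_ ((le_infDist hne).2 fun w hw => ?_)
  · rcases eq_or_ne z 0 with rfl | h0
    · obtain ⟨w, hw⟩ := hne
      refine (infDist_le_dist_of_mem hw).trans ?_
      rw [dist_comm, hw]
      simp
    · have hn : ‖z‖ ≠ 0 := norm_ne_zero_iff.2 h0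
      have hw : (‖z‖⁻¹ : ℝ) • z ∈ sphere (0 : Cn n) 1 := by
        simp [norm_smul, hn]
      refine (infDist_le_dist_of_mem hw).trans_eq ?_
      have h1 : z - (‖z‖⁻¹ : ℝ) • z = (1 - ‖z‖⁻¹ : ℝ) • z := by rw [sub_smul, one_smul]
      have h2 : 1 ≤ ‖z‖⁻¹ := (one_le_inv₀ (norm_pos_iff.2 h0)).2 hz1.le
      rw [dist_eq_norm, h1, norm_smul, Real.norm_eq_abs, abs_of_nonpos (by linarith)]
      field_simp
      ring
  · have h1 : ‖w‖ = 1 := by simpa using hw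
    have h2 := norm_sub_norm_le w z
    rw [dist_comm, dist_eq_norm]
    linarith

/-- The parallelogram law for `A` and `i B`. -/
theorem norm_sq_add_norm_sq_wirtinger (A B : ℂ) :
    ‖(1 / 2 : ℂ) * (A - Complex.I * B)‖ ^ 2 + ‖(1 / 2 : ℂ) * (A + Complex.I * B)‖ ^ 2
      = (‖A‖ ^ 2 + ‖B‖ ^ 2) / 2 := by
  have h := parallelogram_law_with_norm ℝ A (Complex.I * B)
  rw [norm_mul, norm_mul, mul_pow, mul_pow]
  simp only [norm_mul, Complex.norm_I, one_mul] at h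
  norm_num
  linarith

/-- Only comparability matters, so the constant is crude: each of the `2n` real partial derivatives
is at most `2 * normD f z`. -/
theorem norm_fderiv_le_normD (f : Cn n → ℂ) (z : Cn n) :
    ‖fderiv ℝ f z‖ ≤ 4 * n * normD f z := by
  set A : Fin n → ℂ := fun k => fderiv ℝ f z (EuclideanSpace.single k 1) with hA
  set B : Fin n → ℂ := fun k => fderiv ℝ f z (EuclideanSpace.single k Complex.I) with hB
  have hN : normD f z ^ 2 = ∑ k, (‖A k‖ ^ 2 + ‖B k‖ ^ 2) / 2 := by
    rw [normD, Real.sq_sqrt (by positivity), ← Finset.sum_add_distrib]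
    exact Finset.sum_congr rfl fun k _ => norm_sq_add_norm_sq_wirtinger (A k) (B k)
  have hN0 : 0 ≤ normD f z := Real.sqrt_nonneg _
  have hk : ∀ k, ‖A k‖ ≤ 2 * normD f z ∧ ‖B k‖ ≤ 2 * normD f z := fun k => by
    have h1 : (‖A k‖ ^ 2 + ‖B k‖ ^ 2) / 2 ≤ normD f z ^ 2 := by
      rw [hN]
      exact Finset.single_le_sum (f := fun k => (‖A k‖ ^ 2 + ‖B k‖ ^ 2) / 2)
        (fun i _ => by positivity) (Finset.mem_univ k)
    constructor <;> refine le_of_sq_le_sq ?_ (by positivity) <;>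
      nlinarith [sq_nonneg ‖A k‖, sq_nonneg ‖B k‖, sq_nonneg (normD f z)]
  refine ContinuousLinearMap.opNorm_le_bound _ (by positivity) fun v => ?_
  have hv : v = ∑ k, ((v k).re • EuclideanSpace.single k (1 : ℂ)
      + (v k).im • EuclideanSpace.single k Complex.I) := by
    ext j
    simp [Finset.sum_apply, Pi.single_apply, Finset.sum_add_distrib]
  have hfv : fderiv ℝ f z v = ∑ k, ((v k).re • A k + (v k).im • B k) := by
    generalize fderiv ℝ f z = T at *
    conv_lhs => rw [hv]
    simp [hA, hB]
  rw [hfv]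
  refine (norm_sum_le _ _).trans ((Finset.sum_le_card_nsmul _ _ (4 * normD f z * ‖v‖)
    fun k _ => ?_).trans_eq ?_)
  · have h1 : ‖v k‖ ≤ ‖v‖ := PiLp.norm_apply_le v k
    have h2 := (Complex.abs_re_le_norm (v k)).trans h1
    have h3 := (Complex.abs_im_le_norm (v k)).trans h1
    have h4 : |(v k).re| * ‖A k‖ ≤ ‖v‖ * (2 * normD f z) := by
      have := (hk k).1
      gcongr
    have h5 : |(v k).im| * ‖B k‖ ≤ ‖v‖ * (2 * normD f z) := by
      have := (hk k).2
      gcongr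
    refine (norm_add_le _ _).trans ?_
    rw [norm_smul, norm_smul, Real.norm_eq_abs, Real.norm_eq_abs]
    linarith
  · simp
    ring

/-- The normalizing factor is neither 0 nor infinite, so finiteness does not see it. -/
theorem lintegral_normVolume_lt_top_iff {F : Cn n → ℝ≥0∞} :
    ∫⁻ z, F z ∂(normVolume n) < ⊤ ↔ ∫⁻ z in unitBall n, F z < ⊤ := by
  have h1 : (volume (unitBall n))⁻¹ ≠ 0 := ENNReal.inv_ne_zero.2 measure_ball_lt_top.ne
  have h2 : (volume (unitBall n))⁻¹ ≠ ⊤ :=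
    ENNReal.inv_ne_top.2 (measure_ball_pos volume 0 one_pos).ne'
  rw [normVolume, lintegral_smul_measure, smul_eq_mul]
  refine ⟨fun h => ?_, fun h => ENNReal.mul_lt_top h2.lt_top h⟩
  by_contra h3
  rw [not_lt_top_iff.1 h3, ENNReal.mul_top h1] at h
  exact lt_irrefl _ h

theorem integrableOn_of_mem_dirichletSpace [Nontrivial (Cn n)] {f : Cn n → ℂ} {γ α : ℝ}
    (hα : 0 < α) (hγ : 0 ≤ γ) (hf : f ∈ dirichletSpace n γ α) :
    IntegrableOn (fun z => (1 - ‖z‖) ^ γ * ‖fderiv ℝ f z‖ ^ α) (ball (0 : Cn n) 1) := by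
  obtain ⟨hf1, hfin⟩ := hf
  have h1 : energy f γ 0 α < ⊤ :=
    (ENNReal.rpow_lt_top_iff_of_pos (by positivity)).1 (ENNReal.add_lt_top.1 hfin).2
  rw [energy, lintegral_normVolume_lt_top_iff] at h1
  have hDc : ContinuousOn (fderiv ℝ f) (ball (0 : Cn n) 1) :=
    hf1.continuousOn_fderiv_of_isOpen isOpen_ball (by norm_num)
  refine ⟨(ContinuousOn.mul (ContinuousOn.rpow_const (by fun_prop) fun z _ => Or.inr hγ)
    (hDc.norm.rpow_const fun z _ => Or.inr hα.le)).aestronglyMeasurable measurableSet_ball, ?_⟩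
  have hc : ENNReal.ofReal ((4 * n) ^ α) ≠ ⊤ := ENNReal.ofReal_ne_top
  refine lt_of_le_of_lt ?_ (ENNReal.mul_lt_top hc.lt_top h1)
  rw [← lintegral_const_mul' _ _ hc]
  refine setLIntegral_mono' measurableSet_ball fun z hz => ?_
  have hz1 : ‖z‖ < 1 := by simpa using hz
  have hd : 0 < 1 - ‖z‖ := by linarith
  have hN0 : 0 ≤ normD f z := Real.sqrt_nonneg _
  rw [bdryDist_eq hz, ENNReal.rpow_zero, mul_one, ENNReal.ofReal_rpow_of_pos hd,
    ENNReal.ofReal_rpow_of_nonneg hN0 hα.le, ← ENNReal.ofReal_mul (by positivity),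
    ← ENNReal.ofReal_mul (by positivity), Real.enorm_of_nonneg (by positivity)]
  refine ENNReal.ofReal_le_ofReal ?_
  calc (1 - ‖z‖) ^ γ * ‖fderiv ℝ f z‖ ^ α ≤ (1 - ‖z‖) ^ γ * (4 * n * normD f z) ^ α := by
        have := norm_fderiv_le_normD f z
        gcongr
    _ = _ := by
        rw [Real.mul_rpow (by positivity) hN0]
        ring

theorem norm_rpow_le_regPow {X : Type*} {f : X → ℂ} {p : ℝ} (hp : 0 ≤ p) (z : X) :
    ‖f z‖ ^ p ≤ regPow p f z := by
  have h1 : ‖f z‖ ^ p = (‖f z‖ ^ 2) ^ (p / 2) := by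
    rw [← Real.rpow_natCast, ← Real.rpow_mul (norm_nonneg _)]
    congr 1
    push_cast
    ring
  rw [h1, regPow]
  exact Real.rpow_le_rpow (by positivity) (by linarith) (by linarith)

theorem mem_hardySpace_of_sphereIntegral_le [Nontrivial (Cn n)] {f : Cn n → ℂ} {p B : ℝ}
    (hp : 0 < p) (hf : ContinuousOn f (unitBall n))
    (hB : ∀ r ∈ Ioo (0 : ℝ) 1, sphereIntegral volume (regPow p f) r ≤ B) :
    f ∈ hardySpace n p := by
  set σ := (volume : Measure (Cn n)).toSphere with hσ
  have hσ0 : (σ univ)⁻¹ ≠ ⊤ :=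
    ENNReal.inv_ne_top.2 (Measure.measure_univ_ne_zero.2 (Measure.toSphere_ne_zero (volume : Measure (Cn n))))
  have hcont : ∀ r ∈ Ioo (0 : ℝ) 1, Continuous fun ζ : sphere (0 : Cn n) 1 => f (r • (ζ : Cn n)) :=
    fun r hr => hf.comp_continuous (by fun_prop) fun ζ => smul_sphere_mem_ball hr.1.le hr.2 ζ
  have hint : ∀ r ∈ Ioo (0 : ℝ) 1, Integrable
      (fun ζ : sphere (0 : Cn n) 1 => ‖f (r • (ζ : Cn n))‖ ^ p) σ := fun r hr =>
    ((hcont r hr).norm.rpow_const fun _ => Or.inr hp.le).integrable_of_hasCompactSupport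
      (HasCompactSupport.of_compactSpace _)
  refine ⟨(continuousOn_iff_continuous_domRestrict.1 hf).measurable,
    fun r hr => (hint r hr).smul_measure hσ0, ((σ univ)⁻¹.toReal * B) ^ (1 / p), ?_⟩
  rintro _ ⟨r, hr, rfl⟩
  have hreg : Integrable (fun ζ : sphere (0 : Cn n) 1 => regPow p f (r • (ζ : Cn n))) σ :=
    Continuous.integrable_of_hasCompactSupport
      (Continuous.rpow_const ((hcont r hr).norm.pow 2 |>.const_add 1)
        fun ζ => Or.inl (by positivity)) (HasCompactSupport.of_compactSpace _)
  have h1 : ∫ ζ : sphere (0 : Cn n) 1, ‖f (r • (ζ : Cn n))‖ ^ p ∂σ ≤ B :=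
    (integral_mono (hint r hr) hreg fun ζ => norm_rpow_le_regPow hp.le _).trans (hB r hr)
  dsimp only
  rw [integralMean, normSurface, integral_smul_measure, smul_eq_mul]
  exact Real.rpow_le_rpow (mul_nonneg ENNReal.toReal_nonneg
    (integral_nonneg fun ζ => by positivity)) (by gcongr) (by positivity)

theorem mem_bergmanSpace_of_lintegral_regPow_lt_top [Nontrivial (Cn n)] {f : Cn n → ℂ} {p ν : ℝ}
    (hp : 0 < p) (hf : ContinuousOn f (unitBall n))
    (hfin : ∫⁻ z in ball (0 : Cn n) 1, ENNReal.ofReal ((1 - ‖z‖) ^ ν * regPow p f z) < ⊤) :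
    f ∈ bergmanSpace n ν p := by
  refine ⟨hf, ENNReal.add_lt_top.2 ⟨ENNReal.ofReal_lt_top,
    (ENNReal.rpow_lt_top_iff_of_pos (by positivity)).2 ?_⟩⟩
  rw [energy, lintegral_normVolume_lt_top_iff]
  refine lt_of_le_of_lt (setLIntegral_mono' measurableSet_ball fun z hz => ?_) hfin
  have hz1 : ‖z‖ < 1 := by simpa using hz
  have hd : 0 < 1 - ‖z‖ := by linarith
  rw [bdryDist_eq hz, ENNReal.rpow_zero, mul_one, ENNReal.ofReal_rpow_of_pos hd,
    ENNReal.ofReal_rpow_of_nonneg (norm_nonneg _) hp.le, ← ENNReal.ofReal_mul (by positivity)]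
  refine ENNReal.ofReal_le_ofReal ?_
  have := norm_rpow_le_regPow (f := f) hp.le z
  gcongr

end ComplexBall

end YukawaBall

/-! ### The main theorem. -/

theorem mainTheorem7 (n : ℕ) (α γ q τ η : ℝ) (hα : 2 ≤ α) (hα' : α ≤ 2 * n) (hγ : 0 < γ)
    (hq : q = (2 * n + γ) / α - 1) (hτ : 0 ≤ τ) (hη : 0 ≤ η) (f : Cn n → ℂ)
    (hf : f ∈ YukawaBall.heinzClass n 3 ∩ YukawaBall.dirichletSpace n γ α)
    (hY : YukawaBall.SolvesYukawa (fun _ => τ) (fun _ => η) f) :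
    (∀ p : ℝ, p = 1 / q → 2 ≤ p → f ∈ YukawaBall.hardySpace n p) ∧
    (∀ p : ℝ, 2 ≤ p → 2 ≤ p * q → f ∈ YukawaBall.bergmanSpace n (p * q - 2) p) := by
  have hdim := YukawaBall.finrank_real_Cn n
  -- The case `n = 0` is excluded by `2 ≤ α ≤ 2 * n`.
  have hn : 0 < n := by
    rcases Nat.eq_zero_or_pos n with rfl | h
    · norm_num at hα'
      linarith
    · exact h
  have : Nontrivial (Cn n) := Module.nontrivial_of_finrank_pos (R := ℝ) (by omega)
  have hα0 : 0 < α := by linarith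
  have hqα : q * α = 2 * n + γ - α := by
    rw [hq]
    field_simp
  -- This is the role of `α ≤ 2 * n`; together with `γ > 0` it also forces `q > 0`.
  have hγα : γ ≤ q * α := by linarith
  have hq0 : 0 < q := by
    by_contra h
    nlinarith [not_lt.1 h]
  have hq' : q = (Module.finrank ℝ (Cn n) + γ) / α - 1 := by
    rw [hdim, hq]
    push_cast
    rfl
  have hf3 : ContDiffOn ℝ 3 f (ball (0 : Cn n) 1) := hf.1.1
  have hK := YukawaBall.integrableOn_of_mem_dirichletSpace hα0 hγ.le hf.2
  refine ⟨fun p hp hp2 => ?_, fun p hp2 hpq => ?_⟩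
  · have hpq : p * q = 1 := by
      rw [hp]
      field_simp
    obtain ⟨B, hB⟩ := YukawaBall.exists_sphereIntegral_regPow_le volume hτ hη hα hγ.le hq' hq0 hγα
      hf3 hY.2 hK hp2 hpq
    exact YukawaBall.mem_hardySpace_of_sphereIntegral_le (by linarith) hf3.continuousOn hB
  · exact YukawaBall.mem_bergmanSpace_of_lintegral_regPow_lt_top (by linarith) hf3.continuousOn
      (YukawaBall.lintegral_regPow_lt_top volume hτ hη hα hγ.le hq' hq0 hγα hf3 hY.2 hK hp2 hpq)
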